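/- For $q\in\mathbb{C}$ with $|q|<1$ put $(a;q)_\infty=\prod_{k\ge 0}(1-aq^k)$, $(a;q)_n=\prod_{0\le k<n}(1-aq^k)$, $(a_1,\dots,a_m;q)_n=(a_1;q)_n\cdots(a_m;q)_n$ for $n\in\mathbb{N}\cup\{\infty\}$, and $${}_3\phi_2\left[\begin{matrix}a_1,a_2,a_3\\ b_1,b_2\end{matrix};q,z\right]=\sum_{k=0}^\infty\frac{(a_1,a_2,a_3;q)_k}{(q,b_1,b_2;q)_k}z^k .$$ Let $q,\rho,a,b,c,d\in\mathbb{C}$ with $|q|<1$, $\max\{|a|,|b|,|c|,|d|\}<1$ and $cd\rho\ne 0$. (1) Let $f,g\in\mathbb{C}$ with $|g|<1$ and $cfgq^k\neq 1$ for all $k\ge 0$. Then the following integral and series converge absolutely, and $$\frac1{2\pi}\int_{-\pi}^{\pi}\frac{(\rho e^{i\theta}/d,\,qde^{-i\theta}/\rho,\,\rho ce^{-i\theta},\,qe^{i\theta}/c\rho,\,fge^{i\theta};q)_\infty}{(ae^{i\theta},be^{i\theta},ce^{-i\theta},de^{-i\theta},ge^{i\theta};q)_\infty}\,d\theta =\frac{(abcd,cfg,\rho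 c/d,dq/\rho c,\rho,q/\rho;q)_\infty}{(q,ac,ad,bc,bd,cg;q)_\infty}\;{}_3\phi_2\left[\begin{matrix}f,ac,bc\\ cfg,abcd\end{matrix};q,dg\right].$$ (2) Let $f\in\mathbb{C}$ with $|f|<1$. The hypotheses of (1) hold with $(f,g)$ replaced by $(abcd,f)$, and after this replacement the two sides of the identity in (1) become the two sides of Gasper's formula $$\frac1{2\pi}\int_{-\pi}^{\pi}\frac{(\rho e^{i\theta}/d,\,qde^{-i\theta}/\rho,\,\rho ce^{-i\theta},\,qe^{i\theta}/c\rho,\,abcdfe^{i\theta};q)_\infty}{(ae^{i\theta},be^{i\theta},fe^{i\theta},ce^{-i\theta},de^{-i\theta};q)_\infty}\,d\theta =\frac{(abcd,\rho c/d,dq/\rho c,\rho,q/\rho,bcdf,acdf;q)_\infty}{(q,ac,ad,bc,bd,cf,df;q)_\infty},$$ which therefore holds, its integral converging absolutely. (3) Let $f,g,h\in\mathbb{C}$ with $|f|<1$, $|h|<1$ and $cghq^k\ne 1$ for all $k\ge 0$. Then $$\frac1{2\pi}\int_{-\pi}^{\pi}\frac{(\rho e^{i\theta}/d,\,qde^{-i\theta}/\rho,\,\rho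 ce^{-i\theta},\,qe^{i\theta}/c\rho,\,abcdfe^{i\theta},\,ghe^{i\theta};q)_\infty}{(ae^{i\theta},be^{i\theta},fe^{i\theta},he^{i\theta},ce^{-i\theta},de^{-i\theta};q)_\infty}\;{}_3\phi_2\left[\begin{matrix}g,ae^{i\theta},fe^{i\theta}\\ ghe^{i\theta},abcdfe^{i\theta}\end{matrix};q,bcdh\right]d\theta$$ $$=\frac{(abcd,\rho c/d,dq/\rho c,\rho,q/\rho,bcdf,acdf,cgh;q)_\infty}{(q,ac,ad,bc,bd,cf,ch,df;q)_\infty}\;{}_3\phi_2\left[\begin{matrix}g,ac,cf\\ cgh,acdf\end{matrix};q,dh\right].$$ Here the integrand is defined for every $\theta$ with $ghe^{i\theta}q^k\ne1$ for all $k\ge0$, hence for all but finitely many $\theta\in[-\pi,\pi]$; the series in it converges absolutely for each such $\theta$, and the integral and the series on the right converge absolutely. -/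

import Mathlib

noncomputable section

namespace BasicHypergeometric

/-- The infinite `q`-shifted factorial `(a;q)_∞ = ∏_{k ≥ 0} (1 - a q^k)`. -/
def qPochInf (q a : ℂ) : ℂ := ∏' k : ℕ, (1 - a * q ^ k)

/-- The finite `q`-shifted factorial `(a;q)_n = ∏_{0 ≤ k < n} (1 - a q^k)`. -/
def qPoch (q a : ℂ) (n : ℕ) : ℂ := ∏ k ∈ Finset.range n, (1 - a * q ^ k)

/-- The multiple symbol `(a₁, …, a_m; q)_∞`. -/
def qPochInfs (q : ℂ) (as : List ℂ) : ℂ := (as.map fun a => qPochInf q a).prod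

/-- The multiple symbol `(a₁, …, a_m; q)_n`. -/
def qPochs (q : ℂ) (as : List ℂ) (n : ℕ) : ℂ := (as.map fun a => qPoch q a n).prod

/-- The `k`-th term of the basic hypergeometric series `_rφ_s[a₁, …, a_r; b₁, …, b_s; q, z]`. -/
def phiTerm (as bs : List ℂ) (q z : ℂ) (k : ℕ) : ℂ :=
  qPochs q as k / qPochs q (q :: bs) k *
    ((-1) ^ k * q ^ (k.choose 2)) ^ (1 + (bs.length : ℤ) - (as.length : ℤ)) * z ^ k

/-- The basic hypergeometric series `_rφ_s[a₁, …, a_r; b₁, …, b_s; q, z]`. -/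
def phi (as bs : List ℂ) (q z : ℂ) : ℂ := ∑' k : ℕ, phiTerm as bs q z k

/-- `e^{iθ}`. -/
def cis (θ : ℝ) : ℂ := Complex.exp (θ * Complex.I)

/-- The integrand of the first extension of the Askey–Roy integral. -/
def extIntegrand (q ρ a b c d f g : ℂ) (θ : ℝ) : ℂ :=
  qPochInfs q [ρ * cis θ / d, q * d * cis (-θ) / ρ, ρ * c * cis (-θ), q * cis θ / (c * ρ),
      f * g * cis θ] /
    qPochInfs q [a * cis θ, b * cis θ, c * cis (-θ), d * cis (-θ), g * cis θ]

/-- The right-hand side of the first extension of the Askey–Roy integral. -/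
def extValue (q ρ a b c d f g : ℂ) : ℂ :=
  qPochInfs q [a * b * c * d, c * f * g, ρ * c / d, d * q / (ρ * c), ρ, q / ρ] /
    qPochInfs q [q, a * c, a * d, b * c, b * d, c * g] *
    phi [f, a * c, b * c] [c * f * g, a * b * c * d] q (d * g)

/-- The integrand of Gasper's integral. -/
def gasperIntegrand (q ρ a b c d f : ℂ) (θ : ℝ) : ℂ :=
  qPochInfs q [ρ * cis θ / d, q * d * cis (-θ) / ρ, ρ * c * cis (-θ), q * cis θ / (c * ρ),
      a * b * c * d * f * cis θ] /
    qPochInfs q [a * cis θ, b * cis θ, f * cis θ, c * cis (-θ), d * cis (-θ)]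

/-- The right-hand side of Gasper's formula. -/
def gasperValue (q ρ a b c d f : ℂ) : ℂ :=
  qPochInfs q [a * b * c * d, ρ * c / d, d * q / (ρ * c), ρ, q / ρ, b * c * d * f,
      a * c * d * f] /
    qPochInfs q [q, a * c, a * d, b * c, b * d, c * f, d * f]

/-- The integrand of the further extension, defined by its formula for all `θ` with
`g h e^{iθ} q^k ≠ 1` for all `k ≥ 0`, hence for all but finitely many `θ ∈ [-π, π]`. -/
def furtherIntegrand (q ρ a b c d f g h : ℂ) (θ : ℝ) : ℂ :=
  qPochInfs q [ρ * cis θ / d, q * d * cis (-θ) / ρ, ρ * c * cis (-θ), q * cis θ / (c * ρ),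
      a * b * c * d * f * cis θ, g * h * cis θ] /
    qPochInfs q [a * cis θ, b * cis θ, f * cis θ, h * cis θ, c * cis (-θ), d * cis (-θ)] *
    phi [g, a * cis θ, f * cis θ] [g * h * cis θ, a * b * c * d * f * cis θ] q (b * c * d * h)

/-- The right-hand side of the further extension. -/
def furtherValue (q ρ a b c d f g h : ℂ) : ℂ :=
  qPochInfs q [a * b * c * d, ρ * c / d, d * q / (ρ * c), ρ, q / ρ, b * c * d * f,
      a * c * d * f, c * g * h] /
    qPochInfs q [q, a * c, a * d, b * c, b * d, c * f, c * h, d * f] *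
    phi [g, a * c, c * f] [c * g * h, a * c * d * f] q (d * h)

end BasicHypergeometric

end

/-!
Write `P(z) = (z;q)_∞` and `x = e^{iθ}`, and let `D_a F(a) = (F(a) - F(aq)) / a`. Both extensions
come from applying the operator `T = ∑_n (g;q)_n hⁿ D_aⁿ / (q;q)_n` in the parameter `a` to a known
integral evaluation. On a function `F(a) = P(yτa) / (P(xa) P(ya))` the `q`-Leibniz rule and the
`q`-binomial theorem give

`T F = P(ghx) P(yτa) / (P(hx) P(xa) P(ya)) · ₃φ₂[g, xa, τ; ghx, yτa; q, hy]`

(`qDiff_sub`, `hasSum_qDiff`, `opValue_eq`). Since `D_a` is a finite difference, an identity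
`∫ w(θ) F_θ(a) dθ = C F(a)` valid for all `|a| < 1` passes to all `D_aⁿ` (at `a = 0` by continuity),
and absolute convergence allows summation over `n`. This is `integral_opValue`, used three times.

* With `g = 0` it passes from `∫ w₀ / P(ax)` to the Askey–Roy integral `∫ w₀ / (P(ax) P(bx))`
  (`askeyRoy`), where `w₀ = arKernel` is the product of two theta functions over `P(c/x) P(d/x)`.
* Applied to the Askey–Roy integral it gives the first extension (`integral_extIntegrand`).
* Applied to Gasper's integral divided by `P(abcd)`, with `y = bcd` and `τ = fx`, it gives the
  further extension (`integral_furtherIntegrand`).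

Gasper's integral is the case `f = abcd` of the first extension, whose series reduces to a `₂φ₁`
summed by the `q`-Gauss formula (`qGauss`, itself a special case of `hasSum_qDiff`).

It remains to find `∫ w₀ / P(ax)` (`integral_arKernel_div`). The Laurent coefficients of a theta
function divided by `P(d/x)` are `(-ρ/d)ⁿ q^(n(n-1)/2) P(ρqⁿ)` up to a constant factor
(`hasSum_thetaTerm_mul_qPochInf`, which also yields Jacobi's triple product `thetaSeries_eq`), and
the constant term of the product of two such series is again a theta series
(`integral_arKernel`). Replacing `c` by `cq^k` multiplies `w₀` by a multiple of
`∏_{i<k} (x - cqⁱ)`, so the moments of `w₀` in this basis are known, and `1 / P(ax)` expands in it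
by the `q`-binomial theorem. These steps need `q ≠ 0`; the case `q = 0` follows from continuity
in `q`.
-/

noncomputable section

namespace BasicHypergeometric

open Filter Topology Finset MeasureTheory

/-! ### The `q`-shifted factorials -/

section Pochhammer

variable {q : ℂ}

lemma summable_norm_mul_pow (hq : ‖q‖ < 1) (a : ℂ) : Summable fun k : ℕ => ‖-(a * q ^ k)‖ := by
  simpa [norm_mul, norm_pow] using
    (summable_geometric_of_lt_one (norm_nonneg q) hq).mul_left ‖a‖

lemma multipliable_one_sub_mul_pow (hq : ‖q‖ < 1) (a : ℂ) :
    Multipliable fun k : ℕ => 1 - a * q ^ k := by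
  simpa [sub_eq_add_neg] using multipliable_one_add_of_summable (summable_norm_mul_pow hq a)

lemma qPoch_zero (q a : ℂ) : qPoch q a 0 = 1 := by simp [qPoch]

lemma qPoch_succ (q a : ℂ) (n : ℕ) : qPoch q a (n + 1) = qPoch q a n * (1 - a * q ^ n) := by
  simp [qPoch, prod_range_succ]

lemma qPoch_add (q a : ℂ) (m n : ℕ) :
    qPoch q a (m + n) = qPoch q a m * qPoch q (a * q ^ m) n := by
  simp only [qPoch, prod_range_add]
  congr 1
  refine prod_congr rfl fun i _ => ?_
  ring

lemma qPoch_self_succ (q : ℂ) (n : ℕ) : qPoch q q (n + 1) = qPoch q q n * (1 - q ^ (n + 1)) := by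
  rw [qPoch_succ, pow_succ']

lemma tendsto_qPoch (hq : ‖q‖ < 1) (a : ℂ) :
    Tendsto (qPoch q a) atTop (𝓝 (qPochInf q a)) :=
  (multipliable_one_sub_mul_pow hq a).tendsto_prod_tprod_nat

lemma qPochInf_zero (q : ℂ) : qPochInf q 0 = 1 := by simp [qPochInf]

/-- `(a;q)_∞ = (a;q)_n (aqⁿ;q)_∞`. -/
lemma qPoch_mul_qPochInf (hq : ‖q‖ < 1) (a : ℂ) (n : ℕ) :
    qPoch q a n * qPochInf q (a * q ^ n) = qPochInf q a := by
  have h1 : Tendsto (fun m => qPoch q a n * qPoch q (a * q ^ n) m) atTop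
      (𝓝 (qPoch q a n * qPochInf q (a * q ^ n))) :=
    (tendsto_qPoch hq _).const_mul _
  have h2 : Tendsto (fun m => qPoch q a (m + n)) atTop (𝓝 (qPochInf q a)) :=
    (tendsto_add_atTop_iff_nat n).2 (tendsto_qPoch hq a)
  refine tendsto_nhds_unique (h1.congr fun m => ?_) h2
  rw [← qPoch_add, add_comm]

lemma qPochInf_eq_mul (hq : ‖q‖ < 1) (a : ℂ) :
    qPochInf q a = (1 - a) * qPochInf q (a * q) := by
  simpa [qPoch] using (qPoch_mul_qPochInf hq a 1).symm

lemma qPochInf_ne_zero (hq : ‖q‖ < 1) {a : ℂ} (h : ∀ k : ℕ, a * q ^ k ≠ 1) :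
    qPochInf q a ≠ 0 := by
  have := tprod_one_add_ne_zero_of_summable (f := fun k : ℕ => -(a * q ^ k))
    (fun k hk => h k (by linear_combination -hk)) (summable_norm_mul_pow hq a)
  simpa [qPochInf, sub_eq_add_neg] using this

lemma mul_pow_ne_one (hq : ‖q‖ < 1) {a : ℂ} (ha : ‖a‖ < 1) (k : ℕ) : a * q ^ k ≠ 1 := by
  intro h
  have h1 : ‖a * q ^ k‖ = 1 := by rw [h]; simp
  rw [norm_mul, norm_pow] at h1
  nlinarith [pow_le_one₀ (n := k) (norm_nonneg q) hq.le, norm_nonneg a,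
    pow_nonneg (norm_nonneg q) k]

lemma qPochInf_ne_zero_of_norm_lt_one (hq : ‖q‖ < 1) {a : ℂ} (ha : ‖a‖ < 1) :
    qPochInf q a ≠ 0 :=
  qPochInf_ne_zero hq (mul_pow_ne_one hq ha)

lemma qPoch_ne_zero (hq : ‖q‖ < 1) {a : ℂ} (h : qPochInf q a ≠ 0) (n : ℕ) : qPoch q a n ≠ 0 := by
  rw [← qPoch_mul_qPochInf hq a n] at h
  exact left_ne_zero_of_mul h

lemma qPoch_self_ne_zero (hq : ‖q‖ < 1) (n : ℕ) : qPoch q q n ≠ 0 :=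
  qPoch_ne_zero hq (qPochInf_ne_zero_of_norm_lt_one hq hq) n

lemma qPochInf_eq_zero_iff (hq : ‖q‖ < 1) (a : ℂ) :
    qPochInf q a = 0 ↔ ∃ k : ℕ, a * q ^ k = 1 := by
  constructor
  · intro h
    by_contra! h'
    exact qPochInf_ne_zero hq h' h
  · rintro ⟨k, hk⟩
    rw [← qPoch_mul_qPochInf hq a (k + 1), qPoch_succ, hk]
    simp

/-- `(a;q)_n` is bounded uniformly in `n` and in `a` from a bounded set. -/
lemma norm_qPoch_le (hq : ‖q‖ < 1) {a : ℂ} {R : ℝ} (ha : ‖a‖ ≤ R) (n : ℕ) :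
    ‖qPoch q a n‖ ≤ Real.exp (R / (1 - ‖q‖)) := by
  have hR : 0 ≤ R := (norm_nonneg a).trans ha
  calc ‖qPoch q a n‖ = ∏ k ∈ range n, ‖1 - a * q ^ k‖ := by rw [qPoch, norm_prod]
    _ ≤ ∏ k ∈ range n, Real.exp (R * ‖q‖ ^ k) := by
        refine prod_le_prod (fun _ _ => norm_nonneg _) fun k _ => ?_
        calc ‖1 - a * q ^ k‖ ≤ 1 + ‖a‖ * ‖q‖ ^ k := by
              simpa using norm_sub_le (1 : ℂ) (a * q ^ k)
          _ ≤ R * ‖q‖ ^ k + 1 := by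
              rw [add_comm]; gcongr
          _ ≤ _ := Real.add_one_le_exp _
    _ = Real.exp (R * ∑ k ∈ range n, ‖q‖ ^ k) := by rw [← Real.exp_sum, mul_sum]
    _ ≤ _ := by
        rw [Real.exp_le_exp, div_eq_mul_inv, ← tsum_geometric_of_lt_one (norm_nonneg q) hq]
        gcongr
        exact (summable_geometric_of_lt_one (norm_nonneg q) hq).sum_le_tsum _
          fun _ _ => by positivity

lemma norm_qPochInf_le (hq : ‖q‖ < 1) {a : ℂ} {R : ℝ} (ha : ‖a‖ ≤ R) :
    ‖qPochInf q a‖ ≤ Real.exp (R / (1 - ‖q‖)) :=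
  le_of_tendsto (tendsto_qPoch hq a).norm (Eventually.of_forall fun n => norm_qPoch_le hq ha n)

lemma norm_mul_pow_le (hq : ‖q‖ < 1) {a : ℂ} {R : ℝ} (ha : ‖a‖ ≤ R) (n : ℕ) :
    ‖a * q ^ n‖ ≤ R := by
  rw [norm_mul, norm_pow]
  exact (mul_le_of_le_one_right (norm_nonneg a)
    (pow_le_one₀ (norm_nonneg q) hq.le)).trans ha

/-- `1 / (b;q)_n` is bounded in `n` as soon as `(b;q)_∞ ≠ 0`. -/
lemma exists_norm_inv_qPoch_le (hq : ‖q‖ < 1) {b : ℂ} (hb : qPochInf q b ≠ 0) :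
    ∃ M : ℝ, 0 ≤ M ∧ ∀ n, ‖(qPoch q b n)⁻¹‖ ≤ M := by
  refine ⟨Real.exp (‖b‖ / (1 - ‖q‖)) * ‖(qPochInf q b)⁻¹‖, by positivity, fun n => ?_⟩
  have : (qPoch q b n)⁻¹ = qPochInf q (b * q ^ n) * (qPochInf q b)⁻¹ := by
    have h0 := qPoch_ne_zero hq hb n
    rw [← qPoch_mul_qPochInf hq b n] at hb ⊢
    have h1 := right_ne_zero_of_mul hb
    field_simp
  rw [this, norm_mul]
  gcongr
  exact norm_qPochInf_le hq (norm_mul_pow_le hq le_rfl n)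

/-- `(a;q)_∞` is jointly continuous in `q` and `a` for `|q| < 1`. -/
lemma continuousOn_qPochInf :
    ContinuousOn (fun p : ℂ × ℂ => qPochInf p.1 p.2) (Metric.ball 0 1 ×ˢ Set.univ) := by
  rintro ⟨q₀, a₀⟩ ⟨hq₀, -⟩
  simp only [Metric.mem_ball, dist_zero_right] at hq₀
  obtain ⟨r, hr₀, hr⟩ := exists_between hq₀
  have hr0 : 0 ≤ r := (norm_nonneg _).trans hr₀.le
  set K : Set (ℂ × ℂ) := Metric.ball 0 r ×ˢ Metric.ball 0 (‖a₀‖ + 1) with hK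
  have hKo : IsOpen K := Metric.isOpen_ball.prod Metric.isOpen_ball
  have hmem : (q₀, a₀) ∈ K := by simp [hK, hr₀]
  have h := Summable.hasProdLocallyUniformlyOn_nat_one_add (R := ℂ) (K := K)
    (f := fun (k : ℕ) (p : ℂ × ℂ) => -(p.2 * p.1 ^ k)) hKo
    (u := fun k => (‖a₀‖ + 1) * r ^ k) ((summable_geometric_of_lt_one hr0 hr).mul_left _)
    (Eventually.of_forall fun k p hp => by
      obtain ⟨h1, h2⟩ := hp
      simp only [Metric.mem_ball, dist_zero_right] at h1 h2
      rw [norm_neg, norm_mul, norm_pow]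
      gcongr) (fun k => by fun_prop)
  have hc : ContinuousOn (fun p : ℂ × ℂ => ∏' k : ℕ, (1 + -(p.2 * p.1 ^ k))) K := by
    refine TendstoLocallyUniformlyOn.continuousOn
      (hasProdLocallyUniformlyOn_iff_tendstoLocallyUniformlyOn.1 h)
      (Frequently.of_forall fun s => ?_)
    fun_prop
  have := hc.continuousAt (hKo.mem_nhds hmem)
  simpa [qPochInf, sub_eq_add_neg] using this.continuousWithinAt

lemma continuous_qPochInf (hq : ‖q‖ < 1) : Continuous (qPochInf q) := by
  rw [← continuousOn_univ]
  exact continuousOn_qPochInf.comp (f := fun a : ℂ => (q, a)) (by fun_prop)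
    fun a _ => by simp [hq]

/-- `1 / (a;q)_∞` is bounded on every disc of radius less than one. -/
lemma exists_norm_inv_qPochInf_le (hq : ‖q‖ < 1) {r : ℝ} (hr : r < 1) :
    ∃ M : ℝ, 0 ≤ M ∧ ∀ a : ℂ, ‖a‖ ≤ r → ‖(qPochInf q a)⁻¹‖ ≤ M := by
  have hc : ContinuousOn (fun a => (qPochInf q a)⁻¹) (Metric.closedBall 0 r) :=
    (continuous_qPochInf hq).continuousOn.inv₀ fun a ha =>
      qPochInf_ne_zero_of_norm_lt_one hq (lt_of_le_of_lt (by simpa using ha) hr)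
  obtain ⟨M, hM⟩ := (isCompact_closedBall (0 : ℂ) r).exists_bound_of_continuousOn hc
  exact ⟨max M 0, le_max_right _ _, fun a ha =>
    (hM a (by simpa using ha)).trans (le_max_left _ _)⟩

end Pochhammer

/-! ### The `q`-binomial theorem -/

section Binomial

variable {q : ℂ}

lemma summable_qBinomial (hq : ‖q‖ < 1) {α : ℂ} (hα : ‖α‖ < 1) (β : ℂ) :
    Summable fun k : ℕ => ‖(∏ i ∈ range k, (α - β * q ^ i)) / qPoch q q k‖ := by
  obtain ⟨r, hr1, hr2⟩ := exists_between hα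
  have hlim : Tendsto (fun k : ℕ => ‖(α - β * q ^ k) / (1 - q ^ (k + 1))‖) atTop (𝓝 ‖α‖) := by
    have h0 := tendsto_pow_atTop_nhds_zero_of_norm_lt_one hq
    have h1 := (tendsto_add_atTop_iff_nat 1).2 h0
    have := ((h0.const_mul β).const_sub α).div (h1.const_sub 1) (by simp)
    simpa using this.norm
  refine summable_of_ratio_norm_eventually_le hr2 ?_
  filter_upwards [hlim.eventually (gt_mem_nhds hr1)] with k hk
  have : ((∏ i ∈ range (k + 1), (α - β * q ^ i)) / qPoch q q (k + 1)) =
      ((α - β * q ^ k) / (1 - q ^ (k + 1))) *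
        ((∏ i ∈ range k, (α - β * q ^ i)) / qPoch q q k) := by
    rw [prod_range_succ, qPoch_self_succ, div_mul_div_comm, mul_comm, mul_comm (1 - _)]
  rw [norm_norm, norm_norm, this, norm_mul]
  gcongr

/-- The `q`-binomial theorem in homogeneous form, which contains both of Euler's expansions. -/
theorem hasSum_qBinomial (hq : ‖q‖ < 1) {α : ℂ} (hα : ‖α‖ < 1) (β : ℂ) :
    HasSum (fun k : ℕ => (∏ i ∈ range k, (α - β * q ^ i)) / qPoch q q k)
      (qPochInf q β / qPochInf q α) := by
  set c : ℕ → ℂ := fun k => (∏ i ∈ range k, (α - β * q ^ i)) / qPoch q q k with hc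
  have hcs : Summable fun k => ‖c k‖ := summable_qBinomial hq hα β
  have hrec : ∀ k, c (k + 1) * (1 - q ^ (k + 1)) = c k * (α - β * q ^ k) := by
    intro k
    have h1 := qPoch_self_ne_zero hq (k + 1)
    simp only [hc, prod_range_succ]
    rw [qPoch_self_succ] at h1 ⊢
    have h2 := left_ne_zero_of_mul h1
    have h3 := right_ne_zero_of_mul h1
    field_simp
  have hsum : ∀ z : ℂ, ‖z‖ ≤ 1 → Summable fun k => c k * z ^ k := fun z hz => by
    refine Summable.of_norm_bounded hcs fun k => ?_
    rw [norm_mul, norm_pow]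
    exact mul_le_of_le_one_right (norm_nonneg _) (pow_le_one₀ (norm_nonneg z) hz)
  set f : ℂ → ℂ := fun z => ∑' k, c k * z ^ k with hf
  -- The recursion for the coefficients is a functional equation for the generating function `f`;
  -- iterating it and using `f(qⁿ) → f(0) = 1` determines `f(1)`.
  have hfun : ∀ z : ℂ, ‖z‖ ≤ 1 → (1 - α * z) * f z = (1 - β * z) * f (q * z) := by
    intro z hz
    have hqz : ‖q * z‖ ≤ 1 := by
      rw [norm_mul]; exact mul_le_one₀ hq.le (norm_nonneg _) hz
    have h1 : f z - f (q * z) = ∑' k, c k * (1 - q ^ k) * z ^ k := by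
      rw [hf]
      simp only
      rw [← (hsum z hz).tsum_sub (hsum _ hqz)]
      exact tsum_congr fun k => by rw [mul_pow]; ring
    have h2 : Summable fun k => c k * (1 - q ^ k) * z ^ k :=
      ((hsum z hz).sub (hsum _ hqz)).congr fun k => by rw [mul_pow]; ring
    have h3 : z * (α * f z - β * f (q * z)) =
        ∑' k, c (k + 1) * (1 - q ^ (k + 1)) * z ^ (k + 1) := by
      rw [hf]
      simp only
      rw [← tsum_mul_left, ← tsum_mul_left,
        ← ((hsum z hz).mul_left α).tsum_sub ((hsum _ hqz).mul_left β), ← tsum_mul_left]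
      exact tsum_congr fun k => by rw [mul_pow, hrec]; ring
    rw [h2.tsum_eq_zero_add, ← h3] at h1
    simp only [pow_zero, sub_self, mul_zero, zero_mul, zero_add] at h1
    linear_combination h1
  have hiter : ∀ n : ℕ, qPoch q α n * f 1 = qPoch q β n * f (q ^ n) := by
    intro n
    induction n with
    | zero => simp [qPoch_zero]
    | succ n ih =>
      have := hfun (q ^ n) (by rw [norm_pow]; exact pow_le_one₀ (norm_nonneg q) hq.le)
      rw [← pow_succ'] at this
      rw [qPoch_succ, qPoch_succ]
      linear_combination (1 - α * q ^ n) * ih + qPoch q β n * this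
  have hlim : Tendsto (fun n : ℕ => f (q ^ n)) atTop (𝓝 1) := by
    have h0 : Tendsto (fun n : ℕ => f (q ^ n)) atTop (𝓝 (∑' k, c k * 0 ^ k)) := by
      refine tendsto_tsum_of_dominated_convergence hcs (fun k => ?_)
        (Eventually.of_forall fun n k => ?_)
      · exact ((tendsto_pow_atTop_nhds_zero_of_norm_lt_one hq).pow k).const_mul _
      · rw [norm_mul, norm_pow, norm_pow]
        exact mul_le_of_le_one_right (norm_nonneg _)
          (pow_le_one₀ (by positivity) (pow_le_one₀ (norm_nonneg q) hq.le))
    have h1 : ∑' k, c k * (0 : ℂ) ^ k = 1 := by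
      rw [tsum_eq_single 0 (fun k hk => by simp [hk])]
      simp [hc, qPoch_zero]
    rwa [h1] at h0
  have key : qPochInf q α * f 1 = qPochInf q β := by
    have h1 := (tendsto_qPoch hq α).mul_const (f 1)
    have h2 := (tendsto_qPoch hq β).mul hlim
    rw [mul_one] at h2
    exact tendsto_nhds_unique (h1.congr hiter) h2
  have : f 1 = qPochInf q β / qPochInf q α := by
    rw [eq_div_iff (qPochInf_ne_zero_of_norm_lt_one hq hα), mul_comm, key]
  rw [← this]
  simpa [hf] using (hsum 1 (by simp)).hasSum

/-- The `q`-binomial theorem `∑ (A;q)_k z^k / (q;q)_k = (Az;q)_∞ / (z;q)_∞`. -/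
theorem hasSum_qPoch_mul_pow (hq : ‖q‖ < 1) (A : ℂ) {z : ℂ} (hz : ‖z‖ < 1) :
    HasSum (fun k : ℕ => qPoch q A k / qPoch q q k * z ^ k)
      (qPochInf q (A * z) / qPochInf q z) := by
  refine (hasSum_qBinomial hq hz (A * z)).congr_fun fun k => ?_
  have : ∏ i ∈ range k, (z - A * z * q ^ i) = qPoch q A k * z ^ k := by
    rw [qPoch, ← card_range k, ← prod_const, card_range, ← prod_mul_distrib]
    exact prod_congr rfl fun i _ => by ring
  rw [this]
  ring

/-- Euler's expansion of `1 / (z;q)_∞`. -/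
theorem hasSum_inv_qPochInf (hq : ‖q‖ < 1) {z : ℂ} (hz : ‖z‖ < 1) :
    HasSum (fun k : ℕ => z ^ k / qPoch q q k) (qPochInf q z)⁻¹ := by
  have := hasSum_qBinomial hq hz 0
  simpa [qPochInf_zero] using this

end Binomial

/-! ### Iterated `q`-differences -/

section Difference

variable {q : ℂ}

/-- The summands of `qDiff`, indexed by `p = (k, j)` with `k + j = n`. -/
def qDiffTerm (q a x y τ : ℂ) (p : ℕ × ℕ) : ℂ :=
  qPoch q τ p.1 * y ^ p.1 * x ^ p.2 / (qPoch q q p.1 * qPoch q q p.2) *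
    (qPochInf q (y * τ * a * q ^ p.1) / (qPochInf q (x * a * q ^ p.1) * qPochInf q (y * a)))

/-- The normalised iterated `q`-difference `D_aⁿ F / (q;q)_n`, where
`F(a) = (yτa;q)_∞ / ((xa;q)_∞ (ya;q)_∞)` and `D_a F(a) = (F(a) - F(aq)) / a`, written out by the
`q`-Leibniz rule, so that no division by `a` occurs. -/
def qDiff (q : ℂ) (n : ℕ) (a x y τ : ℂ) : ℂ :=
  ∑ p ∈ antidiagonal n, qDiffTerm q a x y τ p

lemma qDiff_zero (q a x y τ : ℂ) : qDiff q 0 a x y τ =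
    qPochInf q (y * τ * a) / (qPochInf q (x * a) * qPochInf q (y * a)) := by
  simp [qDiff, qDiffTerm, qPoch_zero]

lemma norm_mul_lt_one {x a : ℂ} (hx : ‖x‖ ≤ 1) (ha : ‖a‖ < 1) : ‖x * a‖ < 1 := by
  rw [norm_mul]
  exact (mul_le_of_le_one_left (norm_nonneg a) hx).trans_lt ha

lemma norm_mul_pow_lt_one (hq : ‖q‖ < 1) {a : ℂ} (ha : ‖a‖ < 1) (n : ℕ) : ‖a * q ^ n‖ < 1 :=
  (norm_mul_pow_le hq le_rfl n).trans_lt ha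

/-- The `q`-product rule for a single summand: differencing the quotient
`(yτaq^k;q)_∞ / (ya;q)_∞` raises `k`, differencing `1 / (xaq^k;q)_∞` raises `j`. -/
lemma qDiffTerm_sub (hq : ‖q‖ < 1) {a x y : ℂ} (ha : ‖a‖ < 1) (hx : ‖x‖ ≤ 1) (hy : ‖y‖ ≤ 1)
    (τ : ℂ) (k j : ℕ) :
    qDiffTerm q a x y τ (k, j) - qDiffTerm q (a * q) x y τ (k, j) =
      a * ((1 - q ^ (k + 1)) * qDiffTerm q a x y τ (k + 1, j) +
        q ^ k * (1 - q ^ (j + 1)) * qDiffTerm q a x y τ (k, j + 1)) := by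
  have hxa := norm_mul_pow_lt_one hq (norm_mul_lt_one hx ha) k
  have hya := norm_mul_lt_one hy ha
  have e1 := qPochInf_eq_mul hq (x * a * q ^ k)
  have e2 := qPochInf_eq_mul hq (y * a)
  have e3 := qPochInf_eq_mul hq (y * τ * a * q ^ k)
  have n1 := qPochInf_ne_zero_of_norm_lt_one hq hxa
  have n2 := qPochInf_ne_zero_of_norm_lt_one hq hya
  rw [e1] at n1
  rw [e2] at n2
  have n3 := left_ne_zero_of_mul n1
  have n4 := right_ne_zero_of_mul n1
  have n5 := left_ne_zero_of_mul n2
  have n6 := right_ne_zero_of_mul n2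
  have m1 := qPoch_self_ne_zero hq (k + 1)
  have m2 := qPoch_self_ne_zero hq (j + 1)
  rw [qPoch_self_succ] at m1 m2
  have m3 := left_ne_zero_of_mul m1
  have m4 := right_ne_zero_of_mul m1
  have m5 := left_ne_zero_of_mul m2
  have m6 := right_ne_zero_of_mul m2
  simp only [qDiffTerm]
  rw [show x * (a * q) * q ^ k = x * a * q ^ k * q by ring,
    show y * τ * (a * q) * q ^ k = y * τ * a * q ^ k * q by ring,
    show y * (a * q) = y * a * q by ring,
    show x * a * q ^ (k + 1) = x * a * q ^ k * q by ring,
    show y * τ * a * q ^ (k + 1) = y * τ * a * q ^ k * q by ring, e1, e2, e3,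
    qPoch_self_succ, qPoch_self_succ, qPoch_succ]
  generalize qPochInf q (x * a * q ^ k * q) = pA at *
  generalize qPochInf q (y * τ * a * q ^ k * q) = pT at *
  generalize qPochInf q (y * a * q) = pY at *
  generalize qPoch q q k = qk at *
  generalize qPoch q q j = qj at *
  generalize qPoch q τ k = t at *
  generalize hU : 1 - x * a * q ^ k = U at *
  generalize hV : 1 - y * a = V at *
  generalize hX : 1 - q ^ (k + 1) = X at *
  generalize hY : 1 - q ^ (j + 1) = Y at *
  generalize q ^ k = Q at *
  rw [pow_succ, pow_succ]
  field_simp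
  rw [← hU, ← hV]
  ring

/-- The defining recursion `D_a (D_aⁿ F) = D_aⁿ⁺¹ F`. -/
lemma qDiff_sub (hq : ‖q‖ < 1) {a x y : ℂ} (ha : ‖a‖ < 1) (hx : ‖x‖ ≤ 1) (hy : ‖y‖ ≤ 1)
    (τ : ℂ) (n : ℕ) :
    qDiff q n a x y τ - qDiff q n (a * q) x y τ =
      (1 - q ^ (n + 1)) * a * qDiff q (n + 1) a x y τ := by
  set u := qDiffTerm q a x y τ with hu
  have h1 : ∑ p ∈ antidiagonal (n + 1), (1 - q ^ p.1) * u p =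
      ∑ p ∈ antidiagonal n, (1 - q ^ (p.1 + 1)) * u (p.1 + 1, p.2) := by
    rw [Nat.sum_antidiagonal_succ]
    simp
  have h2 : ∑ p ∈ antidiagonal (n + 1), q ^ p.1 * (1 - q ^ p.2) * u p =
      ∑ p ∈ antidiagonal n, q ^ p.1 * (1 - q ^ (p.2 + 1)) * u (p.1, p.2 + 1) := by
    rw [Nat.sum_antidiagonal_succ']
    simp
  have h3 : (1 - q ^ (n + 1)) * ∑ p ∈ antidiagonal (n + 1), u p =
      ∑ p ∈ antidiagonal (n + 1), (1 - q ^ p.1) * u p +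
        ∑ p ∈ antidiagonal (n + 1), q ^ p.1 * (1 - q ^ p.2) * u p := by
    rw [mul_sum, ← sum_add_distrib]
    refine sum_congr rfl fun p hp => ?_
    rw [← mem_antidiagonal.1 hp, pow_add]
    ring
  rw [mul_comm _ a, mul_assoc, qDiff, qDiff, qDiff, h3, h1, h2, ← sum_sub_distrib,
    ← sum_add_distrib, mul_sum]
  exact sum_congr rfl fun p _ => qDiffTerm_sub hq ha hx hy τ p.1 p.2

lemma continuous_qDiff (hq : ‖q‖ < 1) {X : Type*} [TopologicalSpace X] {a x τ : X → ℂ}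
    (ha : Continuous a) (hx : Continuous x) (hτ : Continuous τ) (ha1 : ∀ t, ‖a t‖ < 1)
    (hx1 : ∀ t, ‖x t‖ ≤ 1) {y : ℂ} (hy : ‖y‖ ≤ 1) (n : ℕ) :
    Continuous fun t => qDiff q n (a t) (x t) y (τ t) := by
  refine continuous_finsetSum _ fun p _ => ?_
  simp only [qDiffTerm, qPoch]
  refine Continuous.mul (by fun_prop) (Continuous.div ?_ ?_ fun t => mul_ne_zero ?_ ?_)
  · exact (continuous_qPochInf hq).comp (by fun_prop)
  · exact ((continuous_qPochInf hq).comp (by fun_prop)).mul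
      ((continuous_qPochInf hq).comp (by fun_prop))
  · exact qPochInf_ne_zero_of_norm_lt_one hq
      (norm_mul_pow_lt_one hq (norm_mul_lt_one (hx1 t) (ha1 t)) _)
  · exact qPochInf_ne_zero_of_norm_lt_one hq (norm_mul_lt_one hy (ha1 t))

/-- The summands of `qDiff` are bounded uniformly in `x` and `τ`. -/
lemma exists_norm_qDiffTerm_le (hq : ‖q‖ < 1) {a y : ℂ} (ha : ‖a‖ < 1) (hy : ‖y‖ ≤ 1) (R : ℝ) :
    ∃ M : ℝ, 0 ≤ M ∧ ∀ x τ : ℂ, ‖x‖ ≤ 1 → ‖τ‖ ≤ R → ∀ p : ℕ × ℕ,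
      ‖qDiffTerm q a x y τ p‖ ≤ M * ‖y‖ ^ p.1 := by
  obtain ⟨I, hI0, hI⟩ :=
    exists_norm_inv_qPoch_le hq (qPochInf_ne_zero_of_norm_lt_one hq hq)
  obtain ⟨J, hJ0, hJ⟩ := exists_norm_inv_qPochInf_le hq ha
  set E := Real.exp (R / (1 - ‖q‖)) with hE
  refine ⟨E * (I * I) * (E * (J * J)), by positivity, fun x τ hx hτ p => ?_⟩
  have hxa : ‖x * a * q ^ p.1‖ ≤ ‖a‖ := norm_mul_pow_le hq (by
    rw [norm_mul]; exact mul_le_of_le_one_left (norm_nonneg a) hx) _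
  have hya : ‖y * a‖ ≤ ‖a‖ := by
    rw [norm_mul]; exact mul_le_of_le_one_left (norm_nonneg a) hy
  have hT : ‖y * τ * a * q ^ p.1‖ ≤ R := by
    refine norm_mul_pow_le hq ?_ _
    rw [show y * τ * a = (y * a) * τ by ring, norm_mul]
    exact (mul_le_of_le_one_left (norm_nonneg τ) (hya.trans ha.le)).trans hτ
  have e : qDiffTerm q a x y τ p = qPoch q τ p.1 * ((qPoch q q p.1)⁻¹ * (qPoch q q p.2)⁻¹) *
      (qPochInf q (y * τ * a * q ^ p.1) * ((qPochInf q (x * a * q ^ p.1))⁻¹ *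
        (qPochInf q (y * a))⁻¹)) * y ^ p.1 * x ^ p.2 := by
    simp only [qDiffTerm, div_eq_mul_inv, mul_inv]
    ring
  rw [e]
  calc _ ≤ _ := norm_mul_le _ _
    _ ≤ _ := mul_le_of_le_one_right (norm_nonneg _) (by
      rw [norm_pow]; exact pow_le_one₀ (norm_nonneg x) hx)
    _ ≤ _ := by
      simp only [norm_mul, norm_pow]
      gcongr
      · exact norm_qPoch_le hq hτ _
      · exact hI _
      · exact hI _
      · exact norm_qPochInf_le hq hT
      · exact hJ _ hxa
      · exact hJ _ hya

lemma exists_norm_qDiff_le (hq : ‖q‖ < 1) {a y : ℂ} (ha : ‖a‖ < 1) (hy : ‖y‖ < 1) (R : ℝ) :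
    ∃ M : ℝ, 0 ≤ M ∧ ∀ x τ : ℂ, ‖x‖ ≤ 1 → ‖τ‖ ≤ R → ∀ n : ℕ, ‖qDiff q n a x y τ‖ ≤ M := by
  obtain ⟨M, hM0, hM⟩ := exists_norm_qDiffTerm_le hq ha hy.le R
  have h1y : 0 < 1 - ‖y‖ := sub_pos.2 hy
  refine ⟨M * (1 - ‖y‖)⁻¹, by positivity, fun x τ hx hτ n => ?_⟩
  calc ‖qDiff q n a x y τ‖ ≤ ∑ p ∈ antidiagonal n, M * ‖y‖ ^ p.1 :=
        norm_sum_le_of_le _ fun p _ => hM x τ hx hτ p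
    _ = M * ∑ k ∈ range (n + 1), ‖y‖ ^ k := by
        rw [Nat.sum_antidiagonal_eq_sum_range_succ (fun i _ => M * ‖y‖ ^ i), mul_sum]
    _ ≤ _ := by
        rw [← tsum_geometric_of_lt_one (norm_nonneg y) hy]
        gcongr
        exact (summable_geometric_of_lt_one (norm_nonneg y) hy).sum_le_tsum _
          fun _ _ => by positivity

/-- The value of the operator `∑ (g;q)_n hⁿ D_aⁿ / (q;q)_n` at
`(yτa;q)_∞ / ((xa;q)_∞ (ya;q)_∞)`. It is a multiple of a `₃φ₂` series, but is defined without
a restriction on `ghx`. -/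
def opValue (q g h a x y τ : ℂ) : ℂ :=
  ∑' k : ℕ, qPoch q g k * qPoch q τ k / qPoch q q k * (h * y) ^ k *
    (qPochInf q (g * h * x * q ^ k) * qPochInf q (y * τ * a * q ^ k) /
      (qPochInf q (h * x) * qPochInf q (x * a * q ^ k) * qPochInf q (y * a)))

/-- Summing the double series for `∑ (g;q)_n hⁿ D_aⁿ F / (q;q)_n` by the `q`-binomial theorem. -/
theorem hasSum_qDiff (hq : ‖q‖ < 1) {a x y h : ℂ} (ha : ‖a‖ < 1) (hx : ‖x‖ ≤ 1) (hy : ‖y‖ ≤ 1)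
    (hh : ‖h‖ < 1) (g τ : ℂ) :
    HasSum (fun n : ℕ => qPoch q g n * h ^ n * qDiff q n a x y τ) (opValue q g h a x y τ) := by
  obtain ⟨M, hM0, hM⟩ := exists_norm_qDiffTerm_le hq ha hy ‖τ‖
  set G : ℕ × ℕ → ℂ := fun p =>
    qPoch q g (p.1 + p.2) * h ^ (p.1 + p.2) * qDiffTerm q a x y τ p with hG
  set E := Real.exp (‖g‖ / (1 - ‖q‖)) with hE
  have hGs : Summable G := by
    have hgeo := summable_geometric_of_lt_one (norm_nonneg h) hh
    have hb : Summable fun p : ℕ × ℕ => E * M * (‖h‖ ^ p.1 * ‖h‖ ^ p.2) :=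
      (hgeo.mul_of_nonneg hgeo (fun _ => by positivity) fun _ => by positivity).mul_left _
    refine Summable.of_norm_bounded hb fun p => ?_
    rw [hG]
    simp only [norm_mul, norm_pow]
    calc _ ≤ E * ‖h‖ ^ (p.1 + p.2) * M := by
          gcongr
          · exact norm_qPoch_le hq le_rfl _
          · exact (hM x τ hx le_rfl p).trans (mul_le_of_le_one_right hM0
              (pow_le_one₀ (norm_nonneg y) hy))
      _ = _ := by rw [pow_add]; ring
  have hrow : ∀ k : ℕ, HasSum (fun j : ℕ => G (k, j))
      (qPoch q g k * qPoch q τ k / qPoch q q k * (h * y) ^ k *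
        (qPochInf q (g * h * x * q ^ k) * qPochInf q (y * τ * a * q ^ k) /
          (qPochInf q (h * x) * qPochInf q (x * a * q ^ k) * qPochInf q (y * a)))) := by
    intro k
    have hxh : ‖h * x‖ < 1 := by rw [mul_comm]; exact norm_mul_lt_one hx hh
    have h1 := (hasSum_qPoch_mul_pow hq (g * q ^ k) hxh).mul_left
      (qPoch q g k * qPoch q τ k / qPoch q q k * (h * y) ^ k *
        (qPochInf q (y * τ * a * q ^ k) / (qPochInf q (x * a * q ^ k) * qPochInf q (y * a))))
    rw [show g * q ^ k * (h * x) = g * h * x * q ^ k by ring] at h1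
    have h2 : ∀ c s r u v t : ℂ, c * (r / (u * v)) * (s / t) = c * (s * r / (t * u * v)) := by
      intro c s r u v t
      rw [mul_assoc, div_mul_div_comm, mul_comm r, mul_comm (u * v), mul_assoc t]
    rw [h2] at h1
    refine h1.congr_fun fun j => ?_
    simp only [hG, qDiffTerm, qPoch_add, pow_add, mul_pow, div_eq_mul_inv, mul_inv]
    ring
  have htot : HasSum G (opValue q g h a x y τ) := by
    have h1 := hGs.hasSum
    have h2 := h1.prod_fiberwise hrow
    rw [opValue, h2.tsum_eq]
    exact h1
  have h3 := (HasAntidiagonal.sigmaAntidiagonalEquivProd (A := ℕ)).hasSum_iff.2 htot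
  refine (h3.sigma fun n => hasSum_fintype _).congr_fun fun n => ?_
  rw [qDiff, mul_sum, ← Finset.sum_coe_sort]
  refine sum_congr rfl fun p _ => ?_
  have hp : p.1.1 + p.1.2 = n := mem_antidiagonal.1 p.2
  simp [hG, hp]

/-- Heine's `q`-analogue of Gauss's summation, with the denominators cleared. It is the case
`τ = x`, `y = 1` of `hasSum_qDiff`, where `F(a) = 1 / (a;q)_∞` and the iterated differences are
known. -/
theorem qGauss (hq : ‖q‖ < 1) (A : ℂ) {B w : ℂ} (hB : ‖B‖ ≤ 1) (hw : ‖w‖ < 1) :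
    ∑' k : ℕ, qPoch q A k * qPoch q B k / qPoch q q k * w ^ k *
      qPochInf q (A * B * w * q ^ k) =
    qPochInf q (A * w) * qPochInf q (B * w) / qPochInf q w := by
  set S : ℕ → ℂ := fun n => ∑ p ∈ antidiagonal n,
    qPoch q B p.1 * B ^ p.2 / (qPoch q q p.1 * qPoch q q p.2) with hS
  have hD : ∀ (n : ℕ) (a : ℂ), ‖a‖ < 1 → qDiff q n a B 1 B = S n / qPochInf q a := by
    intro n a ha
    rw [qDiff, hS, sum_div]
    refine sum_congr rfl fun p _ => ?_
    have h1 := qPochInf_ne_zero_of_norm_lt_one hq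
      (norm_mul_pow_lt_one hq (norm_mul_lt_one hB ha) p.1)
    rw [qDiffTerm]
    simp only [one_mul, one_pow, mul_one]
    rw [div_mul_eq_div_div _ (qPochInf q (B * a * q ^ p.1)), div_self h1]
    ring
  have hSrec : ∀ n, S n = 1 / qPoch q q n := by
    intro n
    induction n with
    | zero => simp [hS, qPoch_zero]
    | succ n ih =>
      have ha : ‖(1 / 2 : ℂ)‖ < 1 := by norm_num
      have hqa : ‖(1 / 2 : ℂ) * q‖ < 1 := by simpa using norm_mul_pow_lt_one hq ha 1
      have h0 := qDiff_sub hq ha hB (y := 1) (by simp) B n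
      have h1 := qPochInf_eq_mul hq (1 / 2 : ℂ)
      have h2 := qPochInf_ne_zero_of_norm_lt_one hq hqa
      have h3 := qPoch_self_ne_zero hq (n + 1)
      rw [hD _ _ ha, hD _ _ hqa, hD _ _ ha] at h0
      generalize qPochInf q (1 / 2 * q) = P at h0 h1 h2
      rw [h1] at h0
      rw [qPoch_self_succ] at h3 ⊢
      have h4 := left_ne_zero_of_mul h3
      have h5 := right_ne_zero_of_mul h3
      rw [ih] at h0
      rw [eq_div_iff h3]
      field_simp at h0
      linear_combination -h0
  have hsum := hasSum_qDiff hq (a := 0) (x := B) (y := 1) (by simp) hB (by simp) hw A B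
  have hsum' : HasSum (fun n : ℕ => qPoch q A n * w ^ n * qDiff q n 0 B 1 B)
      (qPochInf q (A * w) / qPochInf q w) := by
    refine (hasSum_qPoch_mul_pow hq A hw).congr_fun fun n => ?_
    rw [hD n 0 (by simp), hSrec, qPochInf_zero]
    ring
  have key := hsum.unique hsum'
  have hBw : qPochInf q (B * w) ≠ 0 :=
    qPochInf_ne_zero_of_norm_lt_one hq (norm_mul_lt_one hB hw)
  rw [mul_comm (qPochInf q (A * w)), mul_div_assoc, ← key, opValue, ← tsum_mul_left]
  refine tsum_congr fun k => ?_
  simp only [mul_zero, zero_mul, qPochInf_zero, mul_one]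
  rw [show A * w * B * q ^ k = A * B * w * q ^ k by ring, mul_comm w B]
  field_simp

end Difference

/-! ### Transfer of integral evaluations -/

section Transfer

variable {q : ℂ}

lemma continuous_cis : Continuous cis := by
  unfold cis; fun_prop

lemma norm_cis (θ : ℝ) : ‖cis θ‖ = 1 := Complex.norm_exp_ofReal_mul_I θ

/-- Continuous functions on the unit disc that agree off the origin are equal. -/
lemma eq_of_eq_off_zero {f g : Metric.ball (0 : ℂ) 1 → ℂ} (hf : Continuous f)
    (hg : Continuous g) (h : ∀ a : Metric.ball (0 : ℂ) 1, (a : ℂ) ≠ 0 → f a = g a) : f = g :=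
  hf.ext_on ((dense_compl_singleton (0 : ℂ)).preimage Metric.isOpen_ball.isOpenMap_subtype_val) hg
    fun a ha => h a ha

/-- If an integral over the circle of `w · F` is known as a function of `a`, where `F` is the
function of `qDiff`, then so are the integrals of all iterated `q`-differences. -/
lemma integral_qDiff (hq : ‖q‖ < 1) {w τ : ℝ → ℂ} (hw : Continuous w) (hτ : Continuous τ)
    {y x' y' τ' C : ℂ} (hy : ‖y‖ ≤ 1) (hx' : ‖x'‖ ≤ 1) (hy' : ‖y'‖ ≤ 1)
    (hF : ∀ a : ℂ, ‖a‖ < 1 → ∫ θ in (-Real.pi)..Real.pi,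
      w θ * (qPochInf q (y * τ θ * a) / (qPochInf q (cis θ * a) * qPochInf q (y * a))) =
      C * (qPochInf q (y' * τ' * a) / (qPochInf q (x' * a) * qPochInf q (y' * a))))
    (n : ℕ) : ∀ a : ℂ, ‖a‖ < 1 →
      ∫ θ in (-Real.pi)..Real.pi, w θ * qDiff q n a (cis θ) y (τ θ) =
        C * qDiff q n a x' y' τ' := by
  have hcont : ∀ (n : ℕ) (a : ℂ), ‖a‖ < 1 →
      IntervalIntegrable (fun θ => w θ * qDiff q n a (cis θ) y (τ θ)) volume
        (-Real.pi) Real.pi := fun n a ha =>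
    (hw.mul (continuous_qDiff hq continuous_const continuous_cis hτ (fun _ => ha)
      (fun t => (norm_cis t).le) hy n)).intervalIntegrable _ _
  induction n with
  | zero => simpa only [qDiff_zero] using hF
  | succ n ih =>
    -- For `a ≠ 0` the induction hypothesis is used at `a` and at `aq`. The point `a = 0`, where the
    -- difference quotient degenerates, is reached by continuity.
    have key : (fun a : Metric.ball (0 : ℂ) 1 => ∫ θ in (-Real.pi)..Real.pi,
        w θ * qDiff q (n + 1) a (cis θ) y (τ θ)) =
        fun a : Metric.ball (0 : ℂ) 1 => C * qDiff q (n + 1) a x' y' τ' := by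
      have hball : ∀ a : Metric.ball (0 : ℂ) 1, ‖(a : ℂ)‖ < 1 := fun a => by
        simpa only [Metric.mem_ball, dist_zero_right] using a.2
      refine eq_of_eq_off_zero ?_ ?_ fun a ha0 => ?_
      · refine intervalIntegral.continuous_parametric_intervalIntegral_of_continuous' ?_ _ _
        exact (hw.comp continuous_snd).mul (continuous_qDiff hq
          (continuous_subtype_val.comp continuous_fst) (continuous_cis.comp continuous_snd)
          (hτ.comp continuous_snd) (fun p => hball p.1) (fun p => (norm_cis p.2).le) hy _)
      · exact continuous_const.mul (continuous_qDiff hq continuous_subtype_val continuous_const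
          continuous_const hball (fun _ => hx') hy' _)
      · have ha := hball a
        have hqa : ‖(a : ℂ) * q‖ < 1 := by simpa using norm_mul_pow_lt_one hq ha 1
        have hne : (1 - q ^ (n + 1)) * (a : ℂ) ≠ 0 := by
          have := qPoch_self_ne_zero hq (n + 1)
          rw [qPoch_self_succ] at this
          exact mul_ne_zero (right_ne_zero_of_mul this) ha0
        refine mul_left_cancel₀ hne ?_
        rw [← intervalIntegral.integral_const_mul, mul_left_comm,
          ← qDiff_sub hq ha hx' hy' τ' n, mul_sub, ← ih _ ha, ← ih _ hqa,
          ← intervalIntegral.integral_sub (hcont n _ ha) (hcont n _ hqa)]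
        congr 1
        funext θ
        rw [← mul_sub, qDiff_sub hq ha (norm_cis θ).le hy]
        ring
    exact fun a ha => congrFun key ⟨a, by simpa using ha⟩

lemma exists_norm_summand_le (hq : ‖q‖ < 1) {τ : ℝ → ℂ} {R : ℝ} (hR : ∀ θ, ‖τ θ‖ ≤ R)
    {a y : ℂ} (ha : ‖a‖ < 1) (hy : ‖y‖ < 1) (g h : ℂ) :
    ∃ K : ℝ, ∀ (n : ℕ) (θ : ℝ),
      ‖qPoch q g n * h ^ n * qDiff q n a (cis θ) y (τ θ)‖ ≤ K * ‖h‖ ^ n := by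
  obtain ⟨M, hM0, hM⟩ := exists_norm_qDiff_le hq ha hy R
  refine ⟨Real.exp (‖g‖ / (1 - ‖q‖)) * M, fun n θ => ?_⟩
  simp only [norm_mul, norm_pow]
  rw [mul_right_comm]
  gcongr
  · exact norm_qPoch_le hq le_rfl n
  · exact hM _ _ (norm_cis θ).le (hR θ) n

lemma continuous_opValue (hq : ‖q‖ < 1) {τ : ℝ → ℂ} (hτ : Continuous τ) {R : ℝ}
    (hR : ∀ θ, ‖τ θ‖ ≤ R) {a y h : ℂ} (ha : ‖a‖ < 1) (hy : ‖y‖ < 1) (hh : ‖h‖ < 1) (g : ℂ) :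
    Continuous fun θ => opValue q g h a (cis θ) y (τ θ) := by
  obtain ⟨K, hK⟩ := exists_norm_summand_le hq hR ha hy g h
  have : (fun θ => opValue q g h a (cis θ) y (τ θ)) =
      fun θ => ∑' n, qPoch q g n * h ^ n * qDiff q n a (cis θ) y (τ θ) :=
    funext fun θ => (hasSum_qDiff hq ha (norm_cis θ).le hy.le hh g (τ θ)).tsum_eq.symm
  rw [this]
  exact continuous_tsum (fun n => continuous_const.mul (continuous_qDiff hq continuous_const
    continuous_cis hτ (fun _ => ha) (fun t => (norm_cis t).le) hy.le n))
    ((summable_geometric_of_lt_one (norm_nonneg h) hh).mul_left K) hK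

/-- An evaluation of `∫ w · F` as a function of `a` remains true after the operator
`∑ (g;q)_n hⁿ D_aⁿ / (q;q)_n` has been applied to both sides. -/
theorem integral_opValue (hq : ‖q‖ < 1) {w τ : ℝ → ℂ} (hw : Continuous w) (hτ : Continuous τ)
    {R : ℝ} (hR : ∀ θ, ‖τ θ‖ ≤ R)
    {y x' y' τ' C : ℂ} (hy : ‖y‖ < 1) (hx' : ‖x'‖ ≤ 1) (hy' : ‖y'‖ ≤ 1)
    (hF : ∀ a : ℂ, ‖a‖ < 1 → ∫ θ in (-Real.pi)..Real.pi,
      w θ * (qPochInf q (y * τ θ * a) / (qPochInf q (cis θ * a) * qPochInf q (y * a))) =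
      C * (qPochInf q (y' * τ' * a) / (qPochInf q (x' * a) * qPochInf q (y' * a))))
    {a h : ℂ} (ha : ‖a‖ < 1) (hh : ‖h‖ < 1) (g : ℂ) :
    ∫ θ in (-Real.pi)..Real.pi, w θ * opValue q g h a (cis θ) y (τ θ) =
      C * opValue q g h a x' y' τ' := by
  obtain ⟨K, hK⟩ := exists_norm_summand_le hq hR ha hy g h
  have hcont : ∀ n, Continuous fun θ =>
      w θ * (qPoch q g n * h ^ n * qDiff q n a (cis θ) y (τ θ)) := fun n =>
    hw.mul (continuous_const.mul (continuous_qDiff hq continuous_const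
      continuous_cis hτ (fun _ => ha) (fun t => (norm_cis t).le) hy.le n))
  have hgeo := (summable_geometric_of_lt_one (norm_nonneg h) hh).mul_left K
  have h1 : HasSum (fun n => ∫ θ in (-Real.pi)..Real.pi,
      w θ * (qPoch q g n * h ^ n * qDiff q n a (cis θ) y (τ θ)))
      (∫ θ in (-Real.pi)..Real.pi, w θ * opValue q g h a (cis θ) y (τ θ)) := by
    refine intervalIntegral.hasSum_integral_of_dominated_convergence
      (fun n θ => ‖w θ‖ * (K * ‖h‖ ^ n)) (fun n => (hcont n).aestronglyMeasurable)
      (fun n => Eventually.of_forall fun θ _ => ?_)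
      (Eventually.of_forall fun θ _ => hgeo.mul_left _) ?_
      (Eventually.of_forall fun θ _ =>
        (hasSum_qDiff hq ha (norm_cis θ).le hy.le hh g (τ θ)).mul_left _)
    · rw [norm_mul]
      gcongr
      exact hK n θ
    · simp_rw [tsum_mul_left]
      exact (hw.norm.mul continuous_const).intervalIntegrable _ _
  have h2 := (hasSum_qDiff hq ha hx' hy' hh g τ').mul_left C
  refine h1.unique (h2.congr_fun fun n => ?_)
  rw [← mul_left_comm, ← integral_qDiff hq hw hτ hy.le hx' hy' hF n a ha,
    ← intervalIntegral.integral_const_mul]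
  congr 1
  funext θ
  ring

end Transfer

/-! ### Theta functions -/

section Theta

variable {q : ℂ}

lemma triangle_add (n m : ℤ) :
    (n + m) * (n + m - 1) / 2 = n * (n - 1) / 2 + m * (m - 1) / 2 + n * m := by
  obtain ⟨a, ha⟩ := Int.even_mul_pred_self n
  obtain ⟨b, hb⟩ := Int.even_mul_pred_self m
  have h : (n + m) * (n + m - 1) = 2 * (a + b + n * m) := by linear_combination ha + hb
  rw [h, ha, hb]
  omega

/-- The general term `z^n q^(n(n-1)/2)`, `n ∈ ℤ`, of the theta series. -/
def thetaTerm (q z : ℂ) (n : ℤ) : ℂ := z ^ n * q ^ (n * (n - 1) / 2)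

lemma thetaTerm_add (hq0 : q ≠ 0) {z : ℂ} (hz : z ≠ 0) (n m : ℤ) :
    thetaTerm q z (n + m) = thetaTerm q z n * thetaTerm q (z * q ^ n) m := by
  simp only [thetaTerm]
  rw [triangle_add, zpow_add₀ hz, zpow_add₀ hq0, zpow_add₀ hq0, mul_zpow, zpow_mul]
  ring

lemma thetaTerm_mul (q z w : ℂ) (n : ℤ) : thetaTerm q (z * w) n = thetaTerm q z n * w ^ n := by
  simp only [thetaTerm, mul_zpow]
  ring

lemma summable_norm_of_succ_eq (hq : ‖q‖ < 1) {f : ℕ → ℂ} (c : ℂ)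
    (h : ∀ n, f (n + 1) = f n * (c * q ^ n)) : Summable fun n => ‖f n‖ := by
  have hlim : Tendsto (fun n : ℕ => ‖c * q ^ n‖) atTop (𝓝 0) := by
    simpa using ((tendsto_pow_atTop_nhds_zero_of_norm_lt_one hq).const_mul c).norm
  refine summable_of_ratio_norm_eventually_le (r := 1 / 2) (by norm_num) ?_
  filter_upwards [hlim.eventually (gt_mem_nhds (show (0 : ℝ) < 1 / 2 by norm_num))] with n hn
  rw [norm_norm, norm_norm, h, norm_mul, mul_comm]
  gcongr

lemma summable_norm_thetaTerm (hq : ‖q‖ < 1) (hq0 : q ≠ 0) {z : ℂ} (hz : z ≠ 0) :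
    Summable fun n : ℤ => ‖thetaTerm q z n‖ := by
  refine Summable.of_nat_of_neg ?_ ?_
  · refine summable_norm_of_succ_eq hq z fun n => ?_
    push_cast
    rw [thetaTerm_add hq0 hz]
    simp [thetaTerm]
  · refine summable_norm_of_succ_eq hq (z⁻¹ * q) fun n => ?_
    push_cast
    rw [neg_add, thetaTerm_add hq0 hz]
    congr 1
    simp [thetaTerm]
    ring

/-- The bilateral theta series `∑ (-z)^n q^(n(n-1)/2)`. -/
def thetaSeries (q z : ℂ) : ℂ := ∑' n : ℤ, thetaTerm q (-z) n

/-- The theta product `(z, q/z; q)_∞`. -/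
def thetaProd (q z : ℂ) : ℂ := qPochInf q z * qPochInf q (q / z)

lemma prod_neg_mul_pow (hq0 : q ≠ 0) (z : ℂ) (m : ℕ) :
    ∏ i ∈ range m, (0 - z * q ^ i) = thetaTerm q (-z) m := by
  induction m with
  | zero => simp [thetaTerm]
  | succ m ih =>
    rw [prod_range_succ, ih]
    push_cast
    rcases eq_or_ne z 0 with rfl | hz
    · have h : ((m : ℤ) + 1) ≠ 0 := by positivity
      simp [thetaTerm, zero_zpow _ h]
    · rw [thetaTerm_add hq0 (neg_ne_zero.2 hz)]
      congr 1
      simp [thetaTerm]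

/-- Euler's expansion of `(z;q)_∞`. -/
theorem hasSum_qPochInf (hq : ‖q‖ < 1) (hq0 : q ≠ 0) (z : ℂ) :
    HasSum (fun m : ℕ => thetaTerm q (-z) m / qPoch q q m) (qPochInf q z) := by
  have h := hasSum_qBinomial hq (α := 0) (by simp) z
  rw [qPochInf_zero, div_one] at h
  exact h.congr_fun fun m => by rw [prod_neg_mul_pow hq0]

/-- The shear `(n, m) ↦ (n + m, m)`. -/
def shearEquiv : ℤ × ℕ ≃ ℤ × ℕ where
  toFun p := (p.1 + p.2, p.2)
  invFun p := (p.1 - p.2, p.2)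
  left_inv p := by simp
  right_inv p := by simp

lemma shearEquiv_apply (p : ℤ × ℕ) : shearEquiv p = (p.1 + p.2, p.2) := rfl

/-- The Laurent expansion of `thetaSeries q z / (w;q)_∞`, where `z` and `1 / w` carry the same
power of the variable. Expanding `(zwqⁿ;q)_∞` by Euler's formula turns the left side into the
product of two series. -/
theorem hasSum_thetaTerm_mul_qPochInf (hq : ‖q‖ < 1) (hq0 : q ≠ 0) {z w : ℂ} (hz : z ≠ 0)
    (hw : ‖w‖ < 1) :
    HasSum (fun n : ℤ => thetaTerm q (-z) n * qPochInf q (z * w * q ^ n))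
      (thetaSeries q z / qPochInf q w) := by
  have hz' := neg_ne_zero.2 hz
  have h1 := summable_norm_thetaTerm hq hq0 hz'
  have h2 : Summable fun m : ℕ => ‖w ^ m / qPoch q q m‖ := by
    simpa using summable_qBinomial hq hw 0
  have h3 : HasSum (fun p : ℤ × ℕ => thetaTerm q (-z) p.1 * (w ^ p.2 / qPoch q q p.2))
      (thetaSeries q z * (qPochInf q w)⁻¹) := by
    have h0 : Summable fun p : ℤ × ℕ => thetaTerm q (-z) p.1 * (w ^ p.2 / qPoch q q p.2) :=
      summable_mul_of_summable_norm (f := thetaTerm q (-z)) (g := fun m => w ^ m / qPoch q q m)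
        h1 h2
    have h0' := tsum_mul_tsum_of_summable_norm (f := thetaTerm q (-z))
      (g := fun m => w ^ m / qPoch q q m) h1 h2
    rw [(hasSum_inv_qPochInf hq hw).tsum_eq] at h0'
    rw [thetaSeries, h0']
    exact h0.hasSum
  have h4 : HasSum (fun p : ℤ × ℕ => thetaTerm q (-z) (p.1 + p.2) * (w ^ p.2 / qPoch q q p.2))
      (thetaSeries q z * (qPochInf q w)⁻¹) := by
    rw [← shearEquiv.hasSum_iff] at h3
    refine h3.congr_fun fun p => ?_
    rw [Function.comp, shearEquiv_apply]
  have h5 : ∀ n : ℤ, HasSum (fun m : ℕ => thetaTerm q (-z) (n + m) * (w ^ m / qPoch q q m))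
      (thetaTerm q (-z) n * qPochInf q (z * w * q ^ n)) := by
    intro n
    have h6 := (hasSum_qPochInf hq hq0 (z * w * q ^ n)).mul_left (thetaTerm q (-z) n)
    refine h6.congr_fun fun m => ?_
    rw [thetaTerm_add hq0 hz', show -(z * w * q ^ n) = -z * q ^ n * w by ring,
      thetaTerm_mul q (-z * q ^ n), zpow_natCast]
    ring
  rw [div_eq_mul_inv]
  exact h4.prod_fiberwise h5

lemma thetaSeries_mul_zpow (hq0 : q ≠ 0) {z : ℂ} (hz : z ≠ 0) (n : ℤ) :
    thetaTerm q (-z) n * thetaSeries q (z * q ^ n) = thetaSeries q z := by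
  rw [thetaSeries, thetaSeries, ← tsum_mul_left, ← (Equiv.addLeft n).tsum_eq (thetaTerm q (-z))]
  refine tsum_congr fun m => ?_
  rw [Equiv.coe_addLeft, thetaTerm_add hq0 (neg_ne_zero.2 hz), neg_mul]

lemma thetaProd_mul (hq : ‖q‖ < 1) (hq0 : q ≠ 0) {z : ℂ} (hz : z ≠ 0) :
    -z * thetaProd q (z * q) = thetaProd q z := by
  have h1 := qPochInf_eq_mul hq z
  have h2 := qPochInf_eq_mul hq z⁻¹
  rw [thetaProd, thetaProd, h1, show q / (z * q) = z⁻¹ by field_simp, h2,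
    show z⁻¹ * q = q / z by field_simp]
  field_simp
  ring

/-- Jacobi's triple product identity. -/
theorem thetaSeries_eq (hq : ‖q‖ < 1) (hq0 : q ≠ 0) {z : ℂ} (hz : z ≠ 0) :
    thetaSeries q z = qPochInf q q * thetaProd q z := by
  -- In the annulus `|q| < |z|` this is the Laurent expansion with `w = q / z`, in which the terms
  -- with negative index vanish. Quasi-periodicity gives the rest.
  have base : ∀ z : ℂ, ‖q‖ < ‖z‖ → thetaSeries q z = qPochInf q q * thetaProd q z := by
    intro z hqz
    have hz : z ≠ 0 := norm_pos_iff.1 ((norm_nonneg q).trans_lt hqz)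
    have hw : ‖q / z‖ < 1 := by
      rw [norm_div]; exact (div_lt_one ((norm_nonneg q).trans_lt hqz)).2 hqz
    have h1 := hasSum_thetaTerm_mul_qPochInf hq hq0 hz hw
    rw [mul_div_cancel₀ q hz] at h1
    have hneg : ∀ n : ℤ, n ∉ Set.range ((↑) : ℕ → ℤ) →
        thetaTerm q (-z) n * qPochInf q (q * q ^ n) = 0 := by
      intro n hn
      have hn0 : n < 0 := by
        by_contra h
        exact hn ⟨n.toNat, Int.toNat_of_nonneg (not_lt.1 h)⟩
      have : qPochInf q (q * q ^ n) = 0 := by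
        refine (qPochInf_eq_zero_iff hq _).2 ⟨(-n - 1).toNat, ?_⟩
        rw [← zpow_natCast, Int.toNat_of_nonneg (by omega), ← zpow_one_add₀ hq0,
          ← zpow_add₀ hq0, show 1 + n + (-n - 1) = 0 by ring, zpow_zero]
      rw [this, mul_zero]
    rw [← Function.Injective.hasSum_iff Nat.cast_injective hneg] at h1
    have h2 := (hasSum_qPochInf hq hq0 z).mul_left (qPochInf q q)
    have h3 := h1.unique (h2.congr_fun fun n => by
      have h4 := qPoch_mul_qPochInf hq q n
      have h5 := qPoch_self_ne_zero hq n
      rw [Function.comp, zpow_natCast, ← h4]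
      field_simp)
    rw [div_eq_iff (qPochInf_ne_zero_of_norm_lt_one hq hw)] at h3
    rw [h3, thetaProd]
    ring
  have step : ∀ (n : ℕ) (z : ℂ), z ≠ 0 → ‖q‖ ^ (n + 1) < ‖z‖ →
      thetaSeries q z = qPochInf q q * thetaProd q z := by
    intro n
    induction n with
    | zero => intro z _ h; exact base z (by simpa using h)
    | succ n ih =>
      intro z hz h
      have hzq : z / q ≠ 0 := div_ne_zero hz hq0
      have h1 : thetaSeries q (z / q) = qPochInf q q * thetaProd q (z / q) := by
        refine ih _ hzq ?_
        rw [norm_div, lt_div_iff₀ (norm_pos_iff.2 hq0)]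
        simpa [pow_succ] using h
      have h2 := thetaSeries_mul_zpow hq0 hzq 1
      have h3 := thetaProd_mul hq hq0 hzq
      rw [zpow_one, div_mul_cancel₀ z hq0, h1, ← h3, div_mul_cancel₀ z hq0] at h2
      have h4 : thetaTerm q (-(z / q)) 1 = -(z / q) := by simp [thetaTerm]
      rw [h4, mul_left_comm] at h2
      exact mul_left_cancel₀ (neg_ne_zero.2 hzq) h2
  obtain ⟨n, hn⟩ := exists_pow_lt_of_lt_one (norm_pos_iff.2 hz) hq
  exact step n z hz ((pow_le_pow_of_le_one (norm_nonneg q) hq.le n.le_succ).trans_lt hn)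

lemma thetaProd_mul_zpow (hq : ‖q‖ < 1) (hq0 : q ≠ 0) {z : ℂ} (hz : z ≠ 0) (n : ℤ) :
    thetaTerm q (-z) n * thetaProd q (z * q ^ n) = thetaProd q z := by
  have h := thetaSeries_mul_zpow hq0 hz n
  rw [thetaSeries_eq hq hq0 hz, thetaSeries_eq hq hq0 (mul_ne_zero hz (zpow_ne_zero n hq0)),
    mul_left_comm] at h
  exact mul_left_cancel₀ (qPochInf_ne_zero_of_norm_lt_one hq hq) h

end Theta

/-! ### Constant terms of Laurent series on the unit circle -/

section ConstantTerm

lemma cis_ne_zero (θ : ℝ) : cis θ ≠ 0 := Complex.exp_ne_zero _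

lemma cis_neg (θ : ℝ) : cis (-θ) = (cis θ)⁻¹ := by
  rw [cis, cis, ← Complex.exp_neg]
  congr 1
  push_cast
  ring

lemma cis_zpow (θ : ℝ) (n : ℤ) : cis θ ^ n = Complex.exp (n * Complex.I * θ) := by
  rw [cis, ← Complex.exp_int_mul]
  congr 1
  ring

lemma continuous_cis_zpow (n : ℤ) : Continuous fun θ => cis θ ^ n :=
  continuous_cis.zpow₀ n fun θ => Or.inl (cis_ne_zero θ)

lemma integral_cis_zpow (n : ℤ) :
    ∫ θ in (-Real.pi)..Real.pi, cis θ ^ n = if n = 0 then 2 * (Real.pi : ℂ) else 0 := by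
  split_ifs with h
  · subst h
    simp
    ring
  · simp_rw [cis_zpow]
    have hn : (n : ℂ) * Complex.I ≠ 0 := mul_ne_zero (by exact_mod_cast h) Complex.I_ne_zero
    rw [integral_exp_mul_complex hn, div_eq_zero_iff, sub_eq_zero]
    left
    rw [Complex.exp_eq_exp_iff_exists_int]
    exact ⟨n, by push_cast; ring⟩

/-- Termwise integration of an absolutely convergent Laurent series against a continuous
function. -/
lemma hasSum_integral_laurent {A : ℤ → ℂ} (hA : Summable fun n => ‖A n‖) {U V : ℝ → ℂ}
    (hU : ∀ θ, HasSum (fun n => A n * cis θ ^ n) (U θ)) (hV : Continuous V) :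
    HasSum (fun n => A n * ∫ θ in (-Real.pi)..Real.pi, cis θ ^ n * V θ)
      (∫ θ in (-Real.pi)..Real.pi, U θ * V θ) := by
  have h1 : HasSum (fun n => ∫ θ in (-Real.pi)..Real.pi, A n * cis θ ^ n * V θ)
      (∫ θ in (-Real.pi)..Real.pi, U θ * V θ) := by
    refine intervalIntegral.hasSum_integral_of_dominated_convergence
      (fun n θ => ‖A n‖ * ‖V θ‖)
      (fun n => ((continuous_const.mul (continuous_cis_zpow n)).mul hV).aestronglyMeasurable)
      (fun n => Eventually.of_forall fun θ _ => ?_)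
      (Eventually.of_forall fun θ _ => hA.mul_right _) ?_
      (Eventually.of_forall fun θ _ => (hU θ).mul_right _)
    · simp [norm_cis]
    · simp_rw [tsum_mul_right]
      exact (continuous_const.mul hV.norm).intervalIntegrable _ _
  refine h1.congr_fun fun n => ?_
  rw [← intervalIntegral.integral_const_mul]
  congr 1
  funext θ
  ring

/-- The constant term of a product of two Laurent series. -/
lemma hasSum_integral_mul {A B : ℤ → ℂ} (hA : Summable fun n => ‖A n‖)
    (hB : Summable fun n => ‖B n‖) {U V : ℝ → ℂ}
    (hU : ∀ θ, HasSum (fun n => A n * cis θ ^ n) (U θ))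
    (hV : ∀ θ, HasSum (fun n => B n * cis θ ^ n) (V θ)) (hVc : Continuous V) :
    HasSum (fun n => A n * B (-n) * (2 * (Real.pi : ℂ)))
      (∫ θ in (-Real.pi)..Real.pi, U θ * V θ) := by
  refine (hasSum_integral_laurent hA hU hVc).congr_fun fun n => ?_
  have h2 := hasSum_integral_laurent hB hV (continuous_cis_zpow n)
  have h3 : HasSum (fun m => B m * ∫ θ in (-Real.pi)..Real.pi, cis θ ^ m * cis θ ^ n)
      (B (-n) * ∫ θ in (-Real.pi)..Real.pi, cis θ ^ (-n) * cis θ ^ n) := by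
    refine hasSum_single _ fun m hm => ?_
    simp_rw [← zpow_add₀ (cis_ne_zero _)]
    rw [integral_cis_zpow, if_neg (by omega), mul_zero]
  have h4 := h2.unique h3
  simp_rw [← zpow_add₀ (cis_ne_zero _), neg_add_cancel] at h4
  rw [integral_cis_zpow, if_pos rfl] at h4
  simp_rw [mul_comm (cis _ ^ n)]
  rw [h4]
  ring

end ConstantTerm

/-! ### The Askey–Roy integral -/

section AskeyRoy

variable {q : ℂ}

/-- The theta-function factor of the Askey–Roy integrand together with its denominators in
`e^{-iθ}`. -/
def arKernel (q ρ c d : ℂ) (θ : ℝ) : ℂ :=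
  qPochInf q (ρ * cis θ / d) * qPochInf q (q * d * cis (-θ) / ρ) *
    qPochInf q (ρ * c * cis (-θ)) * qPochInf q (q * cis θ / (c * ρ)) /
    (qPochInf q (c * cis (-θ)) * qPochInf q (d * cis (-θ)))

/-- The mean value of `arKernel` over the circle. -/
def arConst (q ρ c d : ℂ) : ℂ :=
  qPochInf q (ρ * c / d) * qPochInf q (d * q / (ρ * c)) * qPochInf q ρ * qPochInf q (q / ρ) /
    qPochInf q q

lemma continuous_qPochInf_comp {X : Type*} [TopologicalSpace X] {Q f : X → ℂ}
    (hQ : Continuous Q) (hf : Continuous f) (h : ∀ t, ‖Q t‖ < 1) :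
    Continuous fun t => qPochInf (Q t) (f t) := by
  rw [← continuousOn_univ]
  exact continuousOn_qPochInf.comp (f := fun t => (Q t, f t)) (by fun_prop)
    fun t _ => by simpa using h t

lemma norm_mul_cis {c : ℂ} (θ : ℝ) : ‖c * cis θ‖ = ‖c‖ := by
  rw [norm_mul, norm_cis, mul_one]

lemma qPochInf_mul_cis_ne_zero (hq : ‖q‖ < 1) {c : ℂ} (hc : ‖c‖ < 1) (θ : ℝ) :
    qPochInf q (c * cis θ) ≠ 0 :=
  qPochInf_ne_zero_of_norm_lt_one hq (by rwa [norm_mul_cis])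

lemma continuous_arKernel_comp {X : Type*} [TopologicalSpace X] {Q : X → ℂ} {t : X → ℝ}
    (hQ : Continuous Q) (ht : Continuous t) (hQ1 : ∀ x, ‖Q x‖ < 1) (ρ : ℂ) {c d : ℂ}
    (hc : ‖c‖ < 1) (hd : ‖d‖ < 1) :
    Continuous fun x => arKernel (Q x) ρ c d (t x) := by
  have h1 : Continuous fun x => cis (t x) := continuous_cis.comp ht
  have h2 : Continuous fun x => cis (-t x) := continuous_cis.comp ht.neg
  refine Continuous.div (((Continuous.mul ?_ ?_).mul ?_).mul ?_) (Continuous.mul ?_ ?_) fun x =>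
    mul_ne_zero (qPochInf_mul_cis_ne_zero (hQ1 x) hc _) (qPochInf_mul_cis_ne_zero (hQ1 x) hd _)
  all_goals exact continuous_qPochInf_comp hQ (by fun_prop) hQ1

lemma continuous_arKernel (hq : ‖q‖ < 1) (ρ : ℂ) {c d : ℂ} (hc : ‖c‖ < 1) (hd : ‖d‖ < 1) :
    Continuous (arKernel q ρ c d) :=
  continuous_arKernel_comp continuous_const continuous_id (fun _ => hq) ρ hc hd

/-- The Laurent coefficients on the unit circle of a theta function divided by `(w;q)_∞`. -/
lemma hasSum_laurent_thetaProd (hq : ‖q‖ < 1) (hq0 : q ≠ 0) {z w : ℂ} (hz : z ≠ 0)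
    (hw : ‖w‖ < 1) (θ : ℝ) :
    HasSum (fun n : ℤ => thetaTerm q (-z) n * qPochInf q (z * w * q ^ n) * cis θ ^ n)
      (qPochInf q q * (thetaProd q (z * cis θ) / qPochInf q (w * cis (-θ)))) := by
  have h := hasSum_thetaTerm_mul_qPochInf hq hq0 (mul_ne_zero hz (cis_ne_zero θ))
    (w := w * cis (-θ)) (by rwa [norm_mul_cis])
  rw [thetaSeries_eq hq hq0 (mul_ne_zero hz (cis_ne_zero θ)), mul_div_assoc] at h
  refine h.congr_fun fun n => ?_
  rw [← neg_mul, thetaTerm_mul, cis_neg, show z * cis θ * (w * (cis θ)⁻¹) = z * w by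
    have := cis_ne_zero θ
    field_simp]
  ring

lemma arKernel_eq {ρ c : ℂ} (hq0 : q ≠ 0) (hρ : ρ ≠ 0) (hc0 : c ≠ 0) (d : ℂ) (θ : ℝ) :
    arKernel q ρ c d θ = thetaProd q (ρ / d * cis θ) / qPochInf q (d * cis (-θ)) *
      (thetaProd q (q / (c * ρ) * cis θ) / qPochInf q (c * cis (-θ))) := by
  have e1 : q / (ρ / d * cis θ) = q * d * cis (-θ) / ρ := by
    rw [cis_neg]; simp only [div_eq_mul_inv, mul_inv, inv_inv]; ring
  have e2 : q / (q / (c * ρ) * cis θ) = ρ * c * cis (-θ) := by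
    have := cis_ne_zero θ
    rw [cis_neg]; field_simp
  rw [arKernel, thetaProd, thetaProd, e1, e2, show ρ * cis θ / d = ρ / d * cis θ by ring,
    show q * cis θ / (c * ρ) = q / (c * ρ) * cis θ by ring]
  ring

/-- The Askey–Roy integral with `a = b = 0`, for `q ≠ 0`. -/
lemma integral_arKernel (hq : ‖q‖ < 1) (hq0 : q ≠ 0) {ρ c d : ℂ} (hρ : ρ ≠ 0) (hc0 : c ≠ 0)
    (hd0 : d ≠ 0) (hc : ‖c‖ < 1) (hd : ‖d‖ < 1) :
    ∫ θ in (-Real.pi)..Real.pi, arKernel q ρ c d θ = 2 * (Real.pi : ℂ) * arConst q ρ c d := by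
  have hz1 : ρ / d ≠ 0 := div_ne_zero hρ hd0
  have hz2 : q / (c * ρ) ≠ 0 := div_ne_zero hq0 (mul_ne_zero hc0 hρ)
  have hz3 : ρ * c / d ≠ 0 := div_ne_zero (mul_ne_zero hρ hc0) hd0
  have hU := hasSum_laurent_thetaProd hq hq0 hz1 hd
  have hV := hasSum_laurent_thetaProd hq hq0 hz2 hc
  have hq1 := qPochInf_ne_zero_of_norm_lt_one hq hq
  have hcis0 : cis 0 = 1 := by simp [cis]
  have hA := (hU 0).summable.norm
  have hB := (hV 0).summable.norm
  simp only [hcis0, one_zpow, mul_one] at hA hB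
  have hVc : Continuous fun θ => qPochInf q q *
      (thetaProd q (q / (c * ρ) * cis θ) / qPochInf q (c * cis (-θ))) := by
    unfold thetaProd
    have h1 : Continuous fun θ => cis (-θ) := continuous_cis.comp continuous_neg
    refine continuous_const.mul (Continuous.div (Continuous.mul ?_ ?_) ?_
      fun θ => qPochInf_mul_cis_ne_zero hq hc _)
    · exact (continuous_qPochInf hq).comp (continuous_const.mul continuous_cis)
    · exact (continuous_qPochInf hq).comp (continuous_const.div
        (continuous_const.mul continuous_cis) fun θ => mul_ne_zero hz2 (cis_ne_zero θ))
    · exact (continuous_qPochInf hq).comp (by fun_prop)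
  have h1 := hasSum_integral_mul hA hB hU hV hVc
  have h2 : HasSum (fun n : ℤ => thetaProd q ρ * thetaTerm q (-(ρ * c / d)) n *
      (2 * (Real.pi : ℂ))) (thetaProd q ρ * thetaSeries q (ρ * c / d) * (2 * (Real.pi : ℂ))) :=
    ((summable_norm_thetaTerm hq hq0 (neg_ne_zero.2 hz3)).of_norm.hasSum.mul_left _).mul_right _
  -- The product of the two coefficients is a theta term, by quasi-periodicity in `ρ`.
  have h3 := h1.unique (h2.congr_fun fun n => by
    rw [← thetaProd_mul_zpow hq hq0 hρ n, thetaProd, show ρ / d * d = ρ by field_simp,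
      show q / (c * ρ) * c * q ^ (-n) = q / (ρ * q ^ n) by rw [zpow_neg]; field_simp]
    have h4 : thetaTerm q (-(ρ / d)) n * thetaTerm q (-(q / (c * ρ))) (-n) =
        thetaTerm q (-ρ) n * thetaTerm q (-(ρ * c / d)) n := by
      have e1 : -n * (-n - 1) / 2 = n * (n - 1) / 2 + n := by
        rw [show -n * (-n - 1) = (n + 1) * (n + 1 - 1) by ring, triangle_add]
        simp
      have e2 : (-(ρ / d)) ^ n * (-(q / (c * ρ))) ^ (-n) * q ^ n =
          (-ρ) ^ n * (-(ρ * c / d)) ^ n := by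
        rw [zpow_neg, ← inv_zpow, ← mul_zpow, ← mul_zpow, ← mul_zpow]
        congr 1
        field_simp
      simp only [thetaTerm]
      rw [e1, zpow_add₀ hq0]
      linear_combination (q ^ (n * (n - 1) / 2)) ^ 2 * e2
    linear_combination (qPochInf q (ρ * q ^ n) * qPochInf q (q / (ρ * q ^ n)) *
      (2 * (Real.pi : ℂ))) * h4)
  rw [thetaSeries_eq hq hq0 hz3] at h3
  have h5 : ∫ θ in (-Real.pi)..Real.pi, qPochInf q q *
      (thetaProd q (ρ / d * cis θ) / qPochInf q (d * cis (-θ))) * (qPochInf q q *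
      (thetaProd q (q / (c * ρ) * cis θ) / qPochInf q (c * cis (-θ)))) =
      qPochInf q q * qPochInf q q * ∫ θ in (-Real.pi)..Real.pi, arKernel q ρ c d θ := by
    rw [← intervalIntegral.integral_const_mul]
    congr 1
    funext θ
    rw [arKernel_eq hq0 hρ hc0]
    ring
  rw [h5] at h3
  refine mul_left_cancel₀ (mul_ne_zero hq1 hq1) (h3.trans ?_)
  rw [arConst, thetaProd, thetaProd, show q / (ρ * c / d) = d * q / (ρ * c) by field_simp]
  field_simp

/-- The shift `c ↦ cq` in `arKernel`: the theta function is quasi-periodic, and one factor of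
`(ce^{-iθ};q)_∞` splits off. -/
lemma arKernel_mul_q (hq : ‖q‖ < 1) (hq0 : q ≠ 0) {ρ c : ℂ} (d : ℂ) (hρ : ρ ≠ 0) (hc0 : c ≠ 0)
    (hc : ‖c‖ < 1) (θ : ℝ) :
    -(ρ * c) * arKernel q ρ (c * q) d θ = (cis θ - c) * arKernel q ρ c d θ := by
  have hx := cis_ne_zero θ
  have h1 := qPochInf_mul_cis_ne_zero hq hc (-θ)
  rw [qPochInf_eq_mul hq] at h1
  simp only [arKernel]
  rw [qPochInf_eq_mul hq (c * cis (-θ)), qPochInf_eq_mul hq (ρ * c * cis (-θ)),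
    show q * cis θ / (c * q * ρ) = cis θ / (c * ρ) by field_simp,
    qPochInf_eq_mul hq (cis θ / (c * ρ)),
    show ρ * (c * q) * cis (-θ) = ρ * c * cis (-θ) * q by ring,
    show c * q * cis (-θ) = c * cis (-θ) * q by ring,
    show cis θ / (c * ρ) * q = q * cis θ / (c * ρ) by ring]
  have h2 := left_ne_zero_of_mul h1
  have h3 := right_ne_zero_of_mul h1
  generalize qPochInf q (c * cis (-θ) * q) = P1 at *
  generalize qPochInf q (ρ * c * cis (-θ) * q) = P2 at *
  generalize qPochInf q (q * cis θ / (c * ρ)) = P3 at *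
  have e1 : -(ρ * c) * (1 - cis θ / (c * ρ)) = cis θ * (1 - ρ * c * cis (-θ)) := by
    rw [cis_neg]; field_simp; ring
  have e2 : cis θ - c = cis θ * (1 - c * cis (-θ)) := by
    rw [cis_neg]; field_simp
  rw [e2]
  generalize 1 - c * cis (-θ) = v at *
  generalize qPochInf q (ρ * cis θ / d) * qPochInf q (q * d * cis (-θ) / ρ) = N
  rw [show -(ρ * c) * (N * P2 * ((1 - cis θ / (c * ρ)) * P3) / (P1 * qPochInf q (d * cis (-θ)))) =
    N * P2 * ((-(ρ * c) * (1 - cis θ / (c * ρ))) * P3) / (P1 * qPochInf q (d * cis (-θ))) by ring,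
    e1]
  have hv : v * v⁻¹ = 1 := mul_inv_cancel₀ h2
  linear_combination (-(N * P2 * (cis θ * (1 - ρ * c * cis (-θ)) * P3) /
    (P1 * qPochInf q (d * cis (-θ))))) * hv

lemma arConst_mul_q (hq : ‖q‖ < 1) (hq0 : q ≠ 0) {ρ c d : ℂ} (hρ : ρ ≠ 0) (hc0 : c ≠ 0)
    (hd0 : d ≠ 0) : -(ρ * c) * arConst q ρ (c * q) d = d * arConst q ρ c d := by
  have h := thetaProd_mul hq hq0 (div_ne_zero (mul_ne_zero hρ hc0) hd0)
  rw [thetaProd, thetaProd, show ρ * c / d * q = ρ * (c * q) / d by ring,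
    show q / (ρ * (c * q) / d) = d * q / (ρ * (c * q)) by field_simp,
    show q / (ρ * c / d) = d * q / (ρ * c) by field_simp] at h
  rw [arConst, arConst, show -(ρ * c) = d * -(ρ * c / d) by field_simp]
  linear_combination (d * (qPochInf q ρ * qPochInf q (q / ρ) / qPochInf q q)) * h

/-- The shift `c ↦ cq^k` evaluates the moments of `arKernel` in the basis
`∏_{i<k} (e^{iθ} - cqⁱ)`. -/
lemma integral_prod_mul_arKernel (hq : ‖q‖ < 1) (hq0 : q ≠ 0) {ρ d : ℂ} (hρ : ρ ≠ 0)
    (hd0 : d ≠ 0) (hd : ‖d‖ < 1) (k : ℕ) : ∀ c : ℂ, c ≠ 0 → ‖c‖ < 1 →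
    ∫ θ in (-Real.pi)..Real.pi, (∏ i ∈ range k, (cis θ - c * q ^ i)) * arKernel q ρ c d θ =
      d ^ k * (2 * (Real.pi : ℂ) * arConst q ρ c d) := by
  induction k with
  | zero =>
    intro c hc0 hc
    simpa using integral_arKernel hq hq0 hρ hc0 hd0 hc hd
  | succ k ih =>
    intro c hc0 hc
    have hcq : ‖c * q‖ < 1 := by simpa using norm_mul_pow_lt_one hq hc 1
    have h1 := ih (c * q) (mul_ne_zero hc0 hq0) hcq
    have h2 : ∀ θ, (∏ i ∈ range (k + 1), (cis θ - c * q ^ i)) * arKernel q ρ c d θ =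
        -(ρ * c) * ((∏ i ∈ range k, (cis θ - c * q * q ^ i)) * arKernel q ρ (c * q) d θ) := by
      intro θ
      rw [prod_range_succ', mul_left_comm, arKernel_mul_q hq hq0 d hρ hc0 hc, pow_zero, mul_one,
        mul_assoc]
      congr 1
      exact prod_congr rfl fun i _ => by rw [pow_succ']; ring
    simp_rw [h2]
    rw [intervalIntegral.integral_const_mul, h1]
    linear_combination d ^ k * (2 * (Real.pi : ℂ)) * arConst_mul_q hq hq0 hρ hc0 hd0

/-- The Askey–Roy integral with `b = 0`. -/
theorem integral_arKernel_div (hq : ‖q‖ < 1) {ρ c d : ℂ} (hρ : ρ ≠ 0) (hc0 : c ≠ 0)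
    (hd0 : d ≠ 0) (hc : ‖c‖ < 1) (hd : ‖d‖ < 1) {a : ℂ} (ha : ‖a‖ < 1) :
    ∫ θ in (-Real.pi)..Real.pi, arKernel q ρ c d θ / qPochInf q (a * cis θ) =
      2 * (Real.pi : ℂ) * arConst q ρ c d / (qPochInf q (a * c) * qPochInf q (a * d)) := by
  have hac : ‖a * c‖ < 1 := norm_mul_lt_one ha.le hc
  have had : ‖a * d‖ < 1 := norm_mul_lt_one ha.le hd
  have main : ∀ q : ℂ, ‖q‖ < 1 → q ≠ 0 →
      ∫ θ in (-Real.pi)..Real.pi, arKernel q ρ c d θ / qPochInf q (a * cis θ) =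
      2 * (Real.pi : ℂ) * arConst q ρ c d / (qPochInf q (a * c) * qPochInf q (a * d)) := by
    intro q hq hq0
    have hK := continuous_arKernel hq ρ hc hd
    obtain ⟨I, hI0, hI⟩ :=
      exists_norm_inv_qPoch_le hq (qPochInf_ne_zero_of_norm_lt_one hq hq)
    set E := Real.exp (‖c‖ / (1 - ‖q‖)) with hE
    have hprod : ∀ (k : ℕ) (θ : ℝ), ∏ i ∈ range k, (cis θ - c * q ^ i) =
        cis θ ^ k * qPoch q (c * cis (-θ)) k := by
      intro k θ
      rw [qPoch, ← card_range k, ← prod_const, card_range, ← prod_mul_distrib]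
      refine prod_congr rfl fun i _ => ?_
      have := cis_ne_zero θ
      rw [cis_neg]
      field_simp
    have h1 : HasSum (fun k : ℕ => ∫ θ in (-Real.pi)..Real.pi,
        a ^ k / qPoch q q k * ((∏ i ∈ range k, (cis θ - c * q ^ i)) * arKernel q ρ c d θ))
        (∫ θ in (-Real.pi)..Real.pi,
          qPochInf q (a * c) / qPochInf q (a * cis θ) * arKernel q ρ c d θ) := by
      have hgeo := (summable_geometric_of_lt_one (norm_nonneg a) ha).mul_left (I * E)
      refine intervalIntegral.hasSum_integral_of_dominated_convergence
        (fun k θ => I * E * ‖a‖ ^ k * ‖arKernel q ρ c d θ‖) (fun k => ?_)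
        (fun k => Eventually.of_forall fun θ _ => ?_)
        (Eventually.of_forall fun θ _ => hgeo.mul_right _) ?_
        (Eventually.of_forall fun θ _ => ?_)
      · refine Continuous.aestronglyMeasurable (continuous_const.mul (Continuous.mul ?_ hK))
        exact continuous_finsetProd _ fun i _ => continuous_cis.sub continuous_const
      · have e : ‖a ^ k / qPoch q q k *
            ((∏ i ∈ range k, (cis θ - c * q ^ i)) * arKernel q ρ c d θ)‖ =
            ‖(qPoch q q k)⁻¹‖ * ‖qPoch q (c * cis (-θ)) k‖ * ‖a‖ ^ k * ‖arKernel q ρ c d θ‖ := by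
          rw [hprod]
          simp only [norm_mul, norm_pow, norm_cis, div_eq_mul_inv, one_pow]
          ring
        rw [e]
        gcongr
        · exact hI k
        · exact norm_qPoch_le hq (norm_mul_cis _).le k
      · simp_rw [tsum_mul_right]
        exact (continuous_const.mul hK.norm).intervalIntegrable _ _
      · have h := (hasSum_qBinomial hq (α := a * cis θ) (by rwa [norm_mul_cis])
          (a * c)).mul_right (arKernel q ρ c d θ)
        refine h.congr_fun fun k => ?_
        have : ∏ i ∈ range k, (a * cis θ - a * c * q ^ i) =
            a ^ k * ∏ i ∈ range k, (cis θ - c * q ^ i) := by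
          rw [← card_range k, ← prod_const, card_range, ← prod_mul_distrib]
          exact prod_congr rfl fun i _ => by ring
        rw [this]
        ring
    have h2 : HasSum (fun k : ℕ => ∫ θ in (-Real.pi)..Real.pi,
        a ^ k / qPoch q q k * ((∏ i ∈ range k, (cis θ - c * q ^ i)) * arKernel q ρ c d θ))
        (2 * (Real.pi : ℂ) * arConst q ρ c d * (qPochInf q (a * d))⁻¹) := by
      refine ((hasSum_inv_qPochInf hq had).mul_left _).congr_fun fun k => ?_
      rw [intervalIntegral.integral_const_mul,
        integral_prod_mul_arKernel hq hq0 hρ hd0 hd k c hc0 hc, mul_pow]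
      ring
    have h3 := h1.unique h2
    have h4 := qPochInf_ne_zero_of_norm_lt_one hq hac
    have h5 : ∀ θ, qPochInf q (a * c) / qPochInf q (a * cis θ) * arKernel q ρ c d θ =
        qPochInf q (a * c) * (arKernel q ρ c d θ / qPochInf q (a * cis θ)) := fun θ => by ring
    simp_rw [h5] at h3
    rw [intervalIntegral.integral_const_mul] at h3
    refine mul_left_cancel₀ h4 (h3.trans ?_)
    have h6 := qPochInf_ne_zero_of_norm_lt_one hq had
    field_simp
  -- Both sides are continuous in `q`, which gives the case `q = 0`.
  have hball : ∀ t : Metric.ball (0 : ℂ) 1, ‖(t : ℂ)‖ < 1 := fun t => by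
    simpa only [Metric.mem_ball, dist_zero_right] using t.2
  have key : (fun t : Metric.ball (0 : ℂ) 1 =>
      ∫ θ in (-Real.pi)..Real.pi, arKernel t ρ c d θ / qPochInf t (a * cis θ)) =
      fun t : Metric.ball (0 : ℂ) 1 =>
        2 * (Real.pi : ℂ) * arConst t ρ c d / (qPochInf t (a * c) * qPochInf t (a * d)) := by
    refine eq_of_eq_off_zero ?_ ?_ fun t ht => main t (hball t) ht
    · refine intervalIntegral.continuous_parametric_intervalIntegral_of_continuous' ?_ _ _
      have hQ : Continuous fun p : Metric.ball (0 : ℂ) 1 × ℝ => (p.1 : ℂ) :=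
        continuous_subtype_val.comp continuous_fst
      refine Continuous.div (continuous_arKernel_comp hQ continuous_snd (fun p => hball p.1) ρ hc
        hd) (continuous_qPochInf_comp hQ
          (continuous_const.mul (continuous_cis.comp continuous_snd)) fun p => hball p.1)
        fun p => qPochInf_mul_cis_ne_zero (hball p.1) ha _
    · have hP : ∀ f : Metric.ball (0 : ℂ) 1 → ℂ, Continuous f →
          Continuous fun t : Metric.ball (0 : ℂ) 1 => qPochInf t (f t) := fun f hf =>
        continuous_qPochInf_comp continuous_subtype_val hf hball
      unfold arConst
      refine Continuous.div (continuous_const.mul (Continuous.div ?_ ?_ fun t => ?_)) ?_ fun t => ?_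
      · exact (((hP _ (by fun_prop)).mul (hP _ (by fun_prop))).mul (hP _ (by fun_prop))).mul
          (hP _ (by fun_prop))
      · exact hP _ (by fun_prop)
      · exact qPochInf_ne_zero_of_norm_lt_one (hball t) (hball t)
      · exact (hP _ (by fun_prop)).mul (hP _ (by fun_prop))
      · exact mul_ne_zero (qPochInf_ne_zero_of_norm_lt_one (hball t) hac)
          (qPochInf_ne_zero_of_norm_lt_one (hball t) had)
  exact congrFun key ⟨q, by simpa using hq⟩

lemma opValue_zero_right (q g h a x : ℂ) :
    opValue q g h a x 0 0 =
      qPochInf q (g * h * x) / (qPochInf q (h * x) * qPochInf q (x * a)) := by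
  rw [opValue, tsum_eq_single 0 (fun k hk => by simp [hk])]
  simp [qPoch_zero, qPochInf_zero]

/-- The Askey–Roy integral. -/
theorem askeyRoy (hq : ‖q‖ < 1) {ρ c d : ℂ} (hρ : ρ ≠ 0) (hc0 : c ≠ 0)
    (hd0 : d ≠ 0) (hc : ‖c‖ < 1) (hd : ‖d‖ < 1) {a b : ℂ} (ha : ‖a‖ < 1) (hb : ‖b‖ < 1) :
    ∫ θ in (-Real.pi)..Real.pi,
      arKernel q ρ c d θ / (qPochInf q (a * cis θ) * qPochInf q (b * cis θ)) =
      2 * (Real.pi : ℂ) * arConst q ρ c d * qPochInf q (a * b * c * d) /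
        (qPochInf q (a * c) * qPochInf q (a * d) * qPochInf q (b * c) * qPochInf q (b * d)) := by
  have h := integral_opValue hq (continuous_arKernel hq ρ hc hd) (τ := fun _ => 0)
    continuous_const (R := 0) (fun _ => by simp) (y := 0) (x' := c) (y' := d) (τ' := 0)
    (C := 2 * (Real.pi : ℂ) * arConst q ρ c d) (by simp) hc.le hd.le (fun a ha => by
      have h0 := integral_arKernel_div hq hρ hc0 hd0 hc hd ha
      simp only [mul_zero, zero_mul, qPochInf_zero, mul_one]
      simp_rw [mul_comm _ a, mul_one_div]
      exact h0) ha hb 0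
  have hac := norm_mul_lt_one ha.le hc
  have hbd := norm_mul_lt_one hb.le hd
  have n1 := qPochInf_ne_zero_of_norm_lt_one hq hac
  have h2 : opValue q 0 b a c d 0 = qPochInf q (a * b * c * d) /
      (qPochInf q (a * c) * qPochInf q (a * d) * qPochInf q (b * c) * qPochInf q (b * d)) := by
    have h3 := (hasSum_qPoch_mul_pow hq (a * c) hbd).mul_right
      (1 / (qPochInf q (b * c) * qPochInf q (a * c) * qPochInf q (a * d)))
    rw [opValue]
    have h4 : ∀ k, qPoch q 0 k * qPoch q 0 k / qPoch q q k * (b * d) ^ k *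
        (qPochInf q (0 * b * c * q ^ k) * qPochInf q (d * 0 * a * q ^ k) /
          (qPochInf q (b * c) * qPochInf q (c * a * q ^ k) * qPochInf q (d * a))) =
        qPoch q (a * c) k / qPoch q q k * (b * d) ^ k *
          (1 / (qPochInf q (b * c) * qPochInf q (a * c) * qPochInf q (a * d))) := by
      intro k
      have h5 := qPoch_mul_qPochInf hq (a * c) k
      rw [← h5] at n1 ⊢
      have h6 := left_ne_zero_of_mul n1
      have h7 := right_ne_zero_of_mul n1
      have h8 : qPoch q 0 k = 1 := by simp [qPoch]
      rw [mul_comm c a, mul_comm d a]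
      simp only [mul_zero, zero_mul, qPochInf_zero, h8]
      generalize qPoch q (a * c) k = t at h6 ⊢
      field_simp
    simp_rw [h4]
    rw [h3.tsum_eq, show a * c * (b * d) = a * b * c * d by ring, div_mul_div_comm]
    congr 1 <;> ring
  rw [h2, ← mul_div_assoc] at h
  rw [← h]
  congr 1
  funext θ
  rw [opValue_zero_right, zero_mul, zero_mul, qPochInf_zero, mul_one_div,
    mul_comm (qPochInf q (b * cis θ)), mul_comm (cis θ) a]

end AskeyRoy

/-! ### The series `₃φ₂` -/

section ThreePhiTwo

variable {q : ℂ}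

lemma phiTerm_three_two (q A B C D E z : ℂ) (k : ℕ) :
    phiTerm [A, B, C] [D, E] q z k =
      qPoch q A k * qPoch q B k * qPoch q C k /
        (qPoch q q k * qPoch q D k * qPoch q E k) * z ^ k := by
  simp [phiTerm, qPochs, mul_assoc]

lemma summable_phiTerm (hq : ‖q‖ < 1) (A B C : ℂ) {D E z : ℂ} (hD : qPochInf q D ≠ 0)
    (hE : qPochInf q E ≠ 0) (hz : ‖z‖ < 1) : Summable (phiTerm [A, B, C] [D, E] q z) := by
  obtain ⟨I, hI0, hI⟩ :=
    exists_norm_inv_qPoch_le hq (qPochInf_ne_zero_of_norm_lt_one hq hq)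
  obtain ⟨J, hJ0, hJ⟩ := exists_norm_inv_qPoch_le hq hD
  obtain ⟨K, hK0, hK⟩ := exists_norm_inv_qPoch_le hq hE
  refine Summable.of_norm_bounded ((summable_geometric_of_lt_one (norm_nonneg z) hz).mul_left
    (Real.exp (‖A‖ / (1 - ‖q‖)) * Real.exp (‖B‖ / (1 - ‖q‖)) * Real.exp (‖C‖ / (1 - ‖q‖)) *
      (I * J * K))) fun k => ?_
  rw [phiTerm_three_two, div_eq_mul_inv, mul_inv, mul_inv]
  simp only [norm_mul, norm_pow]
  gcongr
  · exact norm_qPoch_le hq le_rfl k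
  · exact norm_qPoch_le hq le_rfl k
  · exact norm_qPoch_le hq le_rfl k
  · exact hI k
  · exact hJ k
  · exact hK k

/-- `opValue` as a multiple of a `₃φ₂` series. -/
lemma opValue_eq (hq : ‖q‖ < 1) {g h a x y τ : ℂ} (hxa : qPochInf q (x * a) ≠ 0)
    (hghx : qPochInf q (g * h * x) ≠ 0) (hya : qPochInf q (y * τ * a) ≠ 0) :
    opValue q g h a x y τ = qPochInf q (g * h * x) * qPochInf q (y * τ * a) /
      (qPochInf q (h * x) * qPochInf q (x * a) * qPochInf q (y * a)) *
        phi [g, x * a, τ] [g * h * x, y * τ * a] q (h * y) := by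
  rw [opValue, phi, ← tsum_mul_left]
  refine tsum_congr fun k => ?_
  rw [phiTerm_three_two]
  have e1 := qPoch_mul_qPochInf hq (x * a) k
  have e2 := qPoch_mul_qPochInf hq (g * h * x) k
  have e3 := qPoch_mul_qPochInf hq (y * τ * a) k
  have n1 := qPoch_ne_zero hq hxa k
  have n2 := qPoch_ne_zero hq hghx k
  have n3 := qPoch_ne_zero hq hya k
  rw [← e1] at hxa
  have n4 := right_ne_zero_of_mul hxa
  rw [← e1, ← e2, ← e3]
  generalize qPochInf q (x * a * q ^ k) = u1 at *
  generalize qPochInf q (g * h * x * q ^ k) = u2 at *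
  generalize qPochInf q (y * τ * a * q ^ k) = u3 at *
  generalize qPoch q (x * a) k = v1 at *
  generalize qPoch q (g * h * x) k = v2 at *
  generalize qPoch q (y * τ * a) k = v3 at *
  field_simp

end ThreePhiTwo

/-! ### Extensions of the Askey–Roy integral -/

section Extensions

variable {q ρ a b c d : ℂ}

lemma norm_mul_lt_one₂ {x y : ℂ} (hx : ‖x‖ < 1) (hy : ‖y‖ < 1) : ‖x * y‖ < 1 :=
  norm_mul_lt_one hx.le hy

/-- A continuous function on the circle divided by `(be^{iθ};q)_∞` is continuous. -/
lemma continuous_div_qPochInf_cis (hq : ‖q‖ < 1) {w : ℝ → ℂ} (hw : Continuous w)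
    (hb : ‖b‖ < 1) : Continuous fun θ => w θ / qPochInf q (b * cis θ) :=
  hw.div ((continuous_qPochInf hq).comp (continuous_const.mul continuous_cis))
    fun θ => qPochInf_mul_cis_ne_zero hq hb θ

lemma extIntegrand_eq (q ρ a b c d f g : ℂ) (θ : ℝ) :
    extIntegrand q ρ a b c d f g θ =
      arKernel q ρ c d θ / qPochInf q (b * cis θ) * opValue q f g a (cis θ) 0 0 := by
  rw [opValue_zero_right, mul_comm (cis θ) a]
  simp only [extIntegrand, qPochInfs, arKernel, List.map_cons, List.map_nil, List.prod_cons,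
    List.prod_nil, mul_one]
  ring

lemma intervalIntegrable_extIntegrand (hq : ‖q‖ < 1) (ha : ‖a‖ < 1) (hb : ‖b‖ < 1)
    (hc : ‖c‖ < 1) (hd : ‖d‖ < 1) (f : ℂ) {g : ℂ} (hg : ‖g‖ < 1) :
    IntervalIntegrable (extIntegrand q ρ a b c d f g) volume (-Real.pi) Real.pi := by
  have h : extIntegrand q ρ a b c d f g = fun θ =>
      arKernel q ρ c d θ / qPochInf q (b * cis θ) * opValue q f g a (cis θ) 0 0 :=
    funext (extIntegrand_eq q ρ a b c d f g)
  rw [h]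
  exact ((continuous_div_qPochInf_cis hq (continuous_arKernel hq ρ hc hd) hb).mul
    (continuous_opValue hq (τ := fun _ => 0) continuous_const (R := 0) (by simp) ha (by simp)
      hg f)).intervalIntegrable _ _

/-- The operator in `a` applied to the Askey–Roy integral. -/
theorem integral_extIntegrand (hq : ‖q‖ < 1) (hρ : ρ ≠ 0) (hc0 : c ≠ 0) (hd0 : d ≠ 0)
    (ha : ‖a‖ < 1) (hb : ‖b‖ < 1) (hc : ‖c‖ < 1) (hd : ‖d‖ < 1) {f g : ℂ} (hg : ‖g‖ < 1)
    (hcfg : ∀ k : ℕ, c * f * g * q ^ k ≠ 1) :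
    1 / (2 * (Real.pi : ℂ)) * ∫ θ in (-Real.pi)..Real.pi, extIntegrand q ρ a b c d f g θ =
      extValue q ρ a b c d f g := by
  have h := integral_opValue hq
    (continuous_div_qPochInf_cis hq (continuous_arKernel hq ρ hc hd) hb) (τ := fun _ => 0)
    continuous_const (R := 0) (fun _ => by simp) (y := 0) (x' := c) (y' := d) (τ' := b * c)
    (C := 2 * (Real.pi : ℂ) * arConst q ρ c d / (qPochInf q (b * c) * qPochInf q (b * d)))
    (by simp) hc.le hd.le (fun a ha => by
      have h0 := askeyRoy hq hρ hc0 hd0 hc hd ha hb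
      simp only [mul_zero, zero_mul, qPochInf_zero, mul_one]
      rw [show d * (b * c) * a = a * b * c * d by ring, mul_comm c a, mul_comm d a]
      have e : ∀ θ, arKernel q ρ c d θ / qPochInf q (b * cis θ) *
          (1 / qPochInf q (cis θ * a)) =
          arKernel q ρ c d θ / (qPochInf q (a * cis θ) * qPochInf q (b * cis θ)) := fun θ => by
        rw [mul_comm (cis θ) a]; ring
      simp_rw [e]
      rw [h0]
      ring) ha hg f
  have hca := norm_mul_lt_one₂ hc ha
  rw [opValue_eq hq (qPochInf_ne_zero_of_norm_lt_one hq hca)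
    (qPochInf_ne_zero hq fun k => by rw [show f * g * c = c * f * g by ring]; exact hcfg k)
    (qPochInf_ne_zero_of_norm_lt_one hq
      (norm_mul_lt_one₂ (norm_mul_lt_one₂ hd (norm_mul_lt_one₂ hb hc)) ha))] at h
  simp_rw [extIntegrand_eq]
  rw [h, show f * g * c = c * f * g by ring, show d * (b * c) * a = a * b * c * d by ring,
    mul_comm c a, mul_comm g d, mul_comm g c, mul_comm d a]
  have hpi : (2 * (Real.pi : ℂ)) ≠ 0 := by simp [Real.pi_ne_zero]
  simp only [extValue, qPochInfs, arConst, List.map_cons, List.map_nil, List.prod_cons,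
    List.prod_nil, mul_one]
  generalize (2 * (Real.pi : ℂ)) = p at *
  rw [one_div, inv_mul_eq_iff_eq_mul₀ hpi]
  ring

lemma gasper_parameter_ne_one (hq : ‖q‖ < 1) (ha : ‖a‖ < 1) (hb : ‖b‖ < 1)
    (hc : ‖c‖ < 1) (hd : ‖d‖ < 1) {f : ℂ} (hf : ‖f‖ < 1) (k : ℕ) :
    c * (a * b * c * d) * f * q ^ k ≠ 1 :=
  mul_pow_ne_one hq (norm_mul_lt_one₂ (norm_mul_lt_one₂ hc (norm_mul_lt_one₂ (norm_mul_lt_one₂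
    (norm_mul_lt_one₂ ha hb) hc) hd)) hf) k

lemma extIntegrand_eq_gasperIntegrand (q ρ a b c d f : ℂ) (θ : ℝ) :
    extIntegrand q ρ a b c d (a * b * c * d) f θ = gasperIntegrand q ρ a b c d f θ := by
  simp only [extIntegrand, gasperIntegrand, qPochInfs, List.map_cons, List.map_nil,
    List.prod_cons, List.prod_nil, mul_one]
  ring

/-- For `f = abcd` the `₃φ₂` reduces to a `₂φ₁` summable by the `q`-Gauss formula. -/
lemma extValue_eq_gasperValue (hq : ‖q‖ < 1) (ha : ‖a‖ < 1) (hb : ‖b‖ < 1)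
    (hc : ‖c‖ < 1) (hd : ‖d‖ < 1) {f : ℂ} (hf : ‖f‖ < 1) :
    extValue q ρ a b c d (a * b * c * d) f = gasperValue q ρ a b c d f := by
  have hbc := norm_mul_lt_one₂ hb hc
  have hdf := norm_mul_lt_one₂ hd hf
  have h1 := qGauss hq (a * c) hbc.le hdf
  have n1 := qPochInf_ne_zero hq (gasper_parameter_ne_one hq ha hb hc hd hf)
  have n2 : qPochInf q (a * b * c * d) ≠ 0 := qPochInf_ne_zero_of_norm_lt_one hq
    (norm_mul_lt_one₂ (norm_mul_lt_one₂ (norm_mul_lt_one₂ ha hb) hc) hd)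
  have h2 : qPochInf q (c * (a * b * c * d) * f) *
      phi [a * b * c * d, a * c, b * c] [c * (a * b * c * d) * f, a * b * c * d] q (d * f) =
      qPochInf q (a * c * (d * f)) * qPochInf q (b * c * (d * f)) / qPochInf q (d * f) := by
    rw [← h1, phi, ← tsum_mul_left]
    refine tsum_congr fun k => ?_
    have e1 := qPoch_mul_qPochInf hq (c * (a * b * c * d) * f) k
    have m1 := qPoch_ne_zero hq n1 k
    have m2 := qPoch_ne_zero hq n2 k
    rw [phiTerm_three_two, ← e1,
      show a * c * (b * c) * (d * f) * q ^ k = c * (a * b * c * d) * f * q ^ k by ring]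
    generalize qPochInf q (c * (a * b * c * d) * f * q ^ k) = u at *
    generalize qPoch q (c * (a * b * c * d) * f) k = v at *
    generalize qPoch q (a * b * c * d) k = w at *
    field_simp
  simp only [extValue, gasperValue, qPochInfs, List.map_cons, List.map_nil,
    List.prod_cons, List.prod_nil, mul_one]
  rw [show b * c * d * f = b * c * (d * f) by ring, show a * c * d * f = a * c * (d * f) by ring]
  generalize phi _ _ q (d * f) = F at *
  linear_combination (qPochInf q (a * b * c * d) * qPochInf q (ρ * c / d) *
    qPochInf q (d * q / (ρ * c)) * qPochInf q ρ * qPochInf q (q / ρ) /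
    (qPochInf q q * qPochInf q (a * c) * qPochInf q (a * d) * qPochInf q (b * c) *
      qPochInf q (b * d) * qPochInf q (c * f))) * h2

lemma integral_gasperIntegrand (hq : ‖q‖ < 1) (hρ : ρ ≠ 0) (hc0 : c ≠ 0) (hd0 : d ≠ 0)
    (ha : ‖a‖ < 1) (hb : ‖b‖ < 1) (hc : ‖c‖ < 1) (hd : ‖d‖ < 1) {f : ℂ} (hf : ‖f‖ < 1) :
    1 / (2 * (Real.pi : ℂ)) * ∫ θ in (-Real.pi)..Real.pi, gasperIntegrand q ρ a b c d f θ =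
      gasperValue q ρ a b c d f := by
  simp_rw [← extIntegrand_eq_gasperIntegrand]
  rw [← extValue_eq_gasperValue hq ha hb hc hd hf]
  exact integral_extIntegrand hq hρ hc0 hd0 ha hb hc hd hf
    (gasper_parameter_ne_one hq ha hb hc hd hf)

lemma countable_cis_eq (z : ℂ) : {θ : ℝ | cis θ = z}.Countable := by
  rcases Set.eq_empty_or_nonempty {θ : ℝ | cis θ = z} with h | ⟨θ₀, h₀⟩
  · rw [h]; exact Set.countable_empty
  · refine (Set.countable_range fun n : ℤ => θ₀ + n * (2 * Real.pi)).mono fun θ hθ => ?_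
    have h1 : Complex.exp (θ * Complex.I) = Complex.exp (θ₀ * Complex.I) :=
      Eq.trans hθ (Eq.symm h₀)
    obtain ⟨n, hn⟩ := Complex.exp_eq_exp_iff_exists_int.1 h1
    refine ⟨n, ?_⟩
    have h2 : ((θ₀ + n * (2 * Real.pi) : ℝ) : ℂ) = θ := by
      refine mul_right_cancel₀ Complex.I_ne_zero ?_
      rw [hn]
      push_cast
      ring
    exact_mod_cast h2

/-- The equation `z e^{iθ} q^k = 1` is solvable in `k ≥ 0` only for a null set of `θ`. With `z = gh`
this is the exceptional set of the further extension. -/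
lemma ae_mul_cis_mul_pow_ne_one (q z : ℂ) :
    ∀ᵐ θ : ℝ, ∀ k : ℕ, z * cis θ * q ^ k ≠ 1 := by
  rw [ae_all_iff]
  intro k
  filter_upwards [(countable_cis_eq (z * q ^ k)⁻¹).ae_notMem volume] with θ hθ h
  exact hθ (eq_inv_of_mul_eq_one_left (by linear_combination h))

/-- Gasper's integral divided by `(abcd;q)_∞`, in the form to which the operator in `a` applies. -/
lemma integral_gasper_form (hq : ‖q‖ < 1) (hρ : ρ ≠ 0) (hc0 : c ≠ 0) (hd0 : d ≠ 0)
    (hb : ‖b‖ < 1) (hc : ‖c‖ < 1) (hd : ‖d‖ < 1) {f : ℂ} (hf : ‖f‖ < 1) (a : ℂ) (ha : ‖a‖ < 1) :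
    ∫ θ in (-Real.pi)..Real.pi,
      arKernel q ρ c d θ / qPochInf q (b * cis θ) / qPochInf q (f * cis θ) *
        (qPochInf q (b * c * d * (f * cis θ) * a) /
          (qPochInf q (cis θ * a) * qPochInf q (b * c * d * a))) =
      2 * (Real.pi : ℂ) * arConst q ρ c d * qPochInf q (b * c * d * f) /
        (qPochInf q (b * c) * qPochInf q (b * d) * qPochInf q (c * f) * qPochInf q (d * f)) *
        (qPochInf q (d * (c * f) * a) / (qPochInf q (c * a) * qPochInf q (d * a))) := by
  have h := integral_gasperIntegrand hq hρ hc0 hd0 ha hb hc hd hf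
  have hpi : (2 * (Real.pi : ℂ)) ≠ 0 := by simp [Real.pi_ne_zero]
  have n : qPochInf q (a * b * c * d) ≠ 0 := qPochInf_ne_zero_of_norm_lt_one hq
    (norm_mul_lt_one₂ (norm_mul_lt_one₂ (norm_mul_lt_one₂ ha hb) hc) hd)
  have e : ∀ θ, arKernel q ρ c d θ / qPochInf q (b * cis θ) / qPochInf q (f * cis θ) *
        (qPochInf q (b * c * d * (f * cis θ) * a) /
          (qPochInf q (cis θ * a) * qPochInf q (b * c * d * a))) =
      (qPochInf q (a * b * c * d))⁻¹ * gasperIntegrand q ρ a b c d f θ := by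
    intro θ
    rw [show b * c * d * (f * cis θ) * a = a * b * c * d * f * cis θ by ring,
      show b * c * d * a = a * b * c * d by ring, mul_comm (cis θ) a]
    simp only [gasperIntegrand, arKernel, qPochInfs, List.map_cons, List.map_nil,
      List.prod_cons, List.prod_nil, mul_one]
    ring
  simp_rw [e]
  rw [one_div, inv_mul_eq_iff_eq_mul₀ hpi] at h
  rw [intervalIntegral.integral_const_mul, h, inv_mul_eq_iff_eq_mul₀ n]
  rw [show d * (c * f) * a = a * c * d * f by ring, mul_comm c a, mul_comm d a]
  simp only [gasperValue, arConst, qPochInfs, List.map_cons, List.map_nil,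
    List.prod_cons, List.prod_nil, mul_one]
  ring

/-- Off the exceptional set the integrand of the further extension coincides with a function that
is continuous on the whole circle. -/
lemma furtherIntegrand_eq (hq : ‖q‖ < 1) (ha : ‖a‖ < 1) (hb : ‖b‖ < 1) (hc : ‖c‖ < 1)
    (hd : ‖d‖ < 1) {f : ℂ} (hf : ‖f‖ < 1) (g h : ℂ) {θ : ℝ}
    (hθ : ∀ k : ℕ, g * h * cis θ * q ^ k ≠ 1) :
    furtherIntegrand q ρ a b c d f g h θ = qPochInf q (a * b * c * d) *
      (arKernel q ρ c d θ / qPochInf q (b * cis θ) / qPochInf q (f * cis θ) *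
        opValue q g h a (cis θ) (b * c * d) (f * cis θ)) := by
  have hbcd := norm_mul_lt_one₂ (norm_mul_lt_one₂ hb hc) hd
  have hfθ : ‖f * cis θ‖ < 1 := by rwa [norm_mul_cis]
  have n : qPochInf q (a * b * c * d) ≠ 0 := qPochInf_ne_zero_of_norm_lt_one hq
    (norm_mul_lt_one₂ (norm_mul_lt_one₂ (norm_mul_lt_one₂ ha hb) hc) hd)
  rw [opValue_eq hq (by rw [mul_comm]; exact qPochInf_mul_cis_ne_zero hq ha θ)
    (qPochInf_ne_zero hq hθ) (qPochInf_ne_zero_of_norm_lt_one hq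
      (norm_mul_lt_one₂ (norm_mul_lt_one₂ hbcd hfθ) ha)),
    show b * c * d * (f * cis θ) * a = a * b * c * d * f * cis θ by ring,
    show b * c * d * a = a * b * c * d by ring, mul_comm (cis θ) a,
    show h * (b * c * d) = b * c * d * h by ring]
  simp only [furtherIntegrand, arKernel, qPochInfs, List.map_cons, List.map_nil,
    List.prod_cons, List.prod_nil, mul_one]
  generalize qPochInf q (a * b * c * d) = P at *
  generalize phi _ _ q (b * c * d * h) = F
  have hP : P * P⁻¹ = 1 := mul_inv_cancel₀ n
  generalize qPochInf q (ρ * cis θ / d) = x1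
  generalize qPochInf q (q * d * cis (-θ) / ρ) = x2
  generalize qPochInf q (ρ * c * cis (-θ)) = x3
  generalize qPochInf q (q * cis θ / (c * ρ)) = x4
  generalize qPochInf q (a * b * c * d * f * cis θ) = x5
  generalize qPochInf q (g * h * cis θ) = x6
  generalize qPochInf q (a * cis θ) = y1
  generalize qPochInf q (b * cis θ) = y2
  generalize qPochInf q (f * cis θ) = y3
  generalize qPochInf q (h * cis θ) = y4
  generalize qPochInf q (c * cis (-θ)) = y5
  generalize qPochInf q (d * cis (-θ)) = y6
  linear_combination (-(x1 * x2 * x3 * x4 * x5 * x6 / (y1 * y2 * y3 * y4 * y5 * y6) * F)) * hP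

lemma furtherIntegrand_ae_eq (hq : ‖q‖ < 1) (ha : ‖a‖ < 1) (hb : ‖b‖ < 1) (hc : ‖c‖ < 1)
    (hd : ‖d‖ < 1) {f : ℂ} (hf : ‖f‖ < 1) (g h : ℂ) :
    ∀ᵐ θ : ℝ, furtherIntegrand q ρ a b c d f g h θ = qPochInf q (a * b * c * d) *
      (arKernel q ρ c d θ / qPochInf q (b * cis θ) / qPochInf q (f * cis θ) *
        opValue q g h a (cis θ) (b * c * d) (f * cis θ)) := by
  filter_upwards [ae_mul_cis_mul_pow_ne_one q (g * h)] with θ hθ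
  exact furtherIntegrand_eq hq ha hb hc hd hf g h hθ

lemma intervalIntegrable_furtherIntegrand (hq : ‖q‖ < 1) (ha : ‖a‖ < 1) (hb : ‖b‖ < 1)
    (hc : ‖c‖ < 1) (hd : ‖d‖ < 1) {f : ℂ} (hf : ‖f‖ < 1) (g : ℂ) {h : ℂ} (hh : ‖h‖ < 1) :
    IntervalIntegrable (furtherIntegrand q ρ a b c d f g h) volume (-Real.pi) Real.pi := by
  have hcont : Continuous fun θ => qPochInf q (a * b * c * d) *
      (arKernel q ρ c d θ / qPochInf q (b * cis θ) / qPochInf q (f * cis θ) *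
        opValue q g h a (cis θ) (b * c * d) (f * cis θ)) := by
    refine continuous_const.mul (Continuous.mul ?_ ?_)
    · exact continuous_div_qPochInf_cis hq
        (continuous_div_qPochInf_cis hq (continuous_arKernel hq ρ hc hd) hb) hf
    · exact continuous_opValue hq (continuous_const.mul continuous_cis) (R := ‖f‖)
        (fun θ => (norm_mul_cis θ).le) ha (norm_mul_lt_one₂ (norm_mul_lt_one₂ hb hc) hd) hh g
  refine (hcont.intervalIntegrable _ _).congr_ae (ae_restrict_of_ae ?_)
  filter_upwards [furtherIntegrand_ae_eq hq ha hb hc hd hf g h] with θ hθ using hθ.symm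

/-- The operator in `a` applied to Gasper's integral. -/
theorem integral_furtherIntegrand (hq : ‖q‖ < 1) (hρ : ρ ≠ 0) (hc0 : c ≠ 0) (hd0 : d ≠ 0)
    (ha : ‖a‖ < 1) (hb : ‖b‖ < 1) (hc : ‖c‖ < 1) (hd : ‖d‖ < 1) {f g h : ℂ} (hf : ‖f‖ < 1)
    (hh : ‖h‖ < 1) (hcgh : ∀ k : ℕ, c * g * h * q ^ k ≠ 1) :
    1 / (2 * (Real.pi : ℂ)) *
        ∫ θ in (-Real.pi)..Real.pi, furtherIntegrand q ρ a b c d f g h θ =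
      furtherValue q ρ a b c d f g h := by
  have hbcd := norm_mul_lt_one₂ (norm_mul_lt_one₂ hb hc) hd
  have H := integral_opValue hq
    (continuous_div_qPochInf_cis hq
      (continuous_div_qPochInf_cis hq (continuous_arKernel hq ρ hc hd) hb) hf)
    (τ := fun θ => f * cis θ) (continuous_const.mul continuous_cis)
    (fun θ => (norm_mul_cis (c := f) θ).le) hbcd hc.le hd.le
    (integral_gasper_form hq hρ hc0 hd0 hb hc hd hf) ha hh g
  rw [opValue_eq hq (qPochInf_ne_zero_of_norm_lt_one hq (norm_mul_lt_one₂ hc ha))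
    (qPochInf_ne_zero hq fun k => by rw [show g * h * c = c * g * h by ring]; exact hcgh k)
    (qPochInf_ne_zero_of_norm_lt_one hq
      (norm_mul_lt_one₂ (norm_mul_lt_one₂ hd (norm_mul_lt_one₂ hc hf)) ha))] at H
  rw [intervalIntegral.integral_congr_ae ((furtherIntegrand_ae_eq hq ha hb hc hd hf g h).mono
      fun θ hθ _ => hθ), intervalIntegral.integral_const_mul, H,
    show g * h * c = c * g * h by ring, show d * (c * f) * a = a * c * d * f by ring,
    mul_comm c a, mul_comm h c, mul_comm d a, mul_comm h d]
  have hpi : (2 * (Real.pi : ℂ)) ≠ 0 := by simp [Real.pi_ne_zero]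
  simp only [furtherValue, qPochInfs, arConst, List.map_cons, List.map_nil, List.prod_cons,
    List.prod_nil, mul_one]
  generalize (2 * (Real.pi : ℂ)) = p at *
  generalize phi _ _ q (d * h) = F
  rw [one_div, inv_mul_eq_iff_eq_mul₀ hpi]
  ring

end Extensions

end BasicHypergeometric

end

theorem mainTheorem2 (q ρ a b c d : ℂ) (hq : ‖q‖ < 1) (ha : ‖a‖ < 1) (hb : ‖b‖ < 1)
    (hc : ‖c‖ < 1) (hd : ‖d‖ < 1) (hcdρ : c * d * ρ ≠ 0) :
    -- the first extension of the Askey–Roy integral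
    (∀ f g : ℂ, ‖g‖ < 1 → (∀ k : ℕ, c * f * g * q ^ k ≠ 1) →
      IntervalIntegrable (BasicHypergeometric.extIntegrand q ρ a b c d f g)
        MeasureTheory.volume (-Real.pi) Real.pi ∧
      Summable (BasicHypergeometric.phiTerm [f, a * c, b * c] [c * f * g, a * b * c * d]
        q (d * g)) ∧
      1 / (2 * (Real.pi : ℂ)) *
          ∫ θ in (-Real.pi)..Real.pi, BasicHypergeometric.extIntegrand q ρ a b c d f g θ =
        BasicHypergeometric.extValue q ρ a b c d f g) ∧
    -- Gasper's formula is its case `(f, g) = (abcd, f)`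
    (∀ f : ℂ, ‖f‖ < 1 →
      (∀ k : ℕ, c * (a * b * c * d) * f * q ^ k ≠ 1) ∧
      (∀ θ : ℝ, BasicHypergeometric.extIntegrand q ρ a b c d (a * b * c * d) f θ =
        BasicHypergeometric.gasperIntegrand q ρ a b c d f θ) ∧
      BasicHypergeometric.extValue q ρ a b c d (a * b * c * d) f =
        BasicHypergeometric.gasperValue q ρ a b c d f ∧
      IntervalIntegrable (BasicHypergeometric.gasperIntegrand q ρ a b c d f)
        MeasureTheory.volume (-Real.pi) Real.pi ∧
      1 / (2 * (Real.pi : ℂ)) *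
          ∫ θ in (-Real.pi)..Real.pi, BasicHypergeometric.gasperIntegrand q ρ a b c d f θ =
        BasicHypergeometric.gasperValue q ρ a b c d f) ∧
    -- the further extension
    (∀ f g h : ℂ, ‖f‖ < 1 → ‖h‖ < 1 → (∀ k : ℕ, c * g * h * q ^ k ≠ 1) →
      (∀ θ : ℝ, (∀ k : ℕ, g * h * BasicHypergeometric.cis θ * q ^ k ≠ 1) →
        Summable (BasicHypergeometric.phiTerm
          [g, a * BasicHypergeometric.cis θ, f * BasicHypergeometric.cis θ]
          [g * h * BasicHypergeometric.cis θ, a * b * c * d * f * BasicHypergeometric.cis θ]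
          q (b * c * d * h))) ∧
      IntervalIntegrable (BasicHypergeometric.furtherIntegrand q ρ a b c d f g h)
        MeasureTheory.volume (-Real.pi) Real.pi ∧
      Summable (BasicHypergeometric.phiTerm [g, a * c, c * f] [c * g * h, a * c * d * f]
        q (d * h)) ∧
      1 / (2 * (Real.pi : ℂ)) *
          ∫ θ in (-Real.pi)..Real.pi,
            BasicHypergeometric.furtherIntegrand q ρ a b c d f g h θ =
        BasicHypergeometric.furtherValue q ρ a b c d f g h) := by
  obtain ⟨⟨hc0, hd0⟩, hρ⟩ : (c ≠ 0 ∧ d ≠ 0) ∧ ρ ≠ 0 := by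
    simpa [mul_ne_zero_iff] using hcdρ
  have hac := BasicHypergeometric.norm_mul_lt_one₂ ha hc
  have hbcd := BasicHypergeometric.norm_mul_lt_one₂ (BasicHypergeometric.norm_mul_lt_one₂ hb hc) hd
  have habcd : ‖a * b * c * d‖ < 1 := by
    rw [show a * b * c * d = a * (b * c * d) by ring]
    exact BasicHypergeometric.norm_mul_lt_one₂ ha hbcd
  refine ⟨fun f g hg hcfg => ⟨?_, ?_, ?_⟩, fun f hf => ⟨?_, ?_, ?_, ?_, ?_⟩,
    fun f g h hf hh hcgh => ⟨fun θ hθ => ?_, ?_, ?_, ?_⟩⟩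
  · exact BasicHypergeometric.intervalIntegrable_extIntegrand hq ha hb hc hd f hg
  · exact BasicHypergeometric.summable_phiTerm hq _ _ _
      (BasicHypergeometric.qPochInf_ne_zero hq hcfg)
      (BasicHypergeometric.qPochInf_ne_zero_of_norm_lt_one hq habcd)
      (BasicHypergeometric.norm_mul_lt_one₂ hd hg)
  · exact BasicHypergeometric.integral_extIntegrand hq hρ hc0 hd0 ha hb hc hd hg hcfg
  · exact BasicHypergeometric.gasper_parameter_ne_one hq ha hb hc hd hf
  · exact BasicHypergeometric.extIntegrand_eq_gasperIntegrand q ρ a b c d f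
  · exact BasicHypergeometric.extValue_eq_gasperValue hq ha hb hc hd hf
  · have h := BasicHypergeometric.intervalIntegrable_extIntegrand (ρ := ρ) hq ha hb hc hd
      (a * b * c * d) hf
    rwa [show BasicHypergeometric.extIntegrand q ρ a b c d (a * b * c * d) f =
      BasicHypergeometric.gasperIntegrand q ρ a b c d f from
        funext (BasicHypergeometric.extIntegrand_eq_gasperIntegrand q ρ a b c d f)] at h
  · exact BasicHypergeometric.integral_gasperIntegrand hq hρ hc0 hd0 ha hb hc hd hf
  · refine BasicHypergeometric.summable_phiTerm hq _ _ _
      (BasicHypergeometric.qPochInf_ne_zero hq hθ)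
      (BasicHypergeometric.qPochInf_mul_cis_ne_zero hq
        (BasicHypergeometric.norm_mul_lt_one₂ habcd hf) θ)
      (BasicHypergeometric.norm_mul_lt_one₂ hbcd hh)
  · exact BasicHypergeometric.intervalIntegrable_furtherIntegrand hq ha hb hc hd hf g hh
  · exact BasicHypergeometric.summable_phiTerm hq _ _ _
      (BasicHypergeometric.qPochInf_ne_zero hq hcgh)
      (BasicHypergeometric.qPochInf_ne_zero_of_norm_lt_one hq
        (BasicHypergeometric.norm_mul_lt_one₂ (BasicHypergeometric.norm_mul_lt_one₂ hac hd) hf))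
      (BasicHypergeometric.norm_mul_lt_one₂ hd hh)
  · exact BasicHypergeometric.integral_furtherIntegrand hq hρ hc0 hd0 ha hb hc hd hf hh hcgh
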